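/- Let $\mathbb Z^3\subset\mathbb R^3$, let $\|\cdot\|$ be the Euclidean norm, $d(x)=\mathrm{dist}(x,\mathbb Z^3)$ and $C_0=\{x\in\mathbb R^3: |x_i|\le \tfrac12,\ i=1,2,3\}$. For $z\in\mathbb C$ with $\operatorname{Im} z>0$ let $\sqrt z$ be the principal square root, and for $x\neq y$ in $\mathbb R^3$ let $$G_0(x,y;z)=\frac1{4\pi}\,\frac{e^{i\sqrt z\,\|x-y\|}}{\|x-y\|}.$$ For $\omega=(\omega_j)_{j\in\mathbb Z^3}$ real with $\inf_j|\omega_j|>0$, let $\Gamma(z,\omega)$ be the infinite matrix, indexed by $\mathbb Z^3\times\mathbb Z^3$, $$[\Gamma(z,\omega)]_{ij}=\Big(\frac1{\omega_j}-\frac{i\sqrt z}{4\pi}\Big)\delta_{ij}-G_0(i,j;z)\,(1-\delta_{ij}).$$ **Theorem 2.3.** Let $z\in\mathbb C$ with $\operatorname{Im} z>0$. There are finite constants $\widetilde C=\widetilde C_z>0$ and $\widetilde\gamma=\widetilde\gamma(z)>0$, depending only on $z$, such that for every real $\omega=(\omega_j)_{j\in\mathbb Z^3}$ with $\inf_j|\omega_j|>0$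 the matrix $\Gamma(z,\omega)$ defines a bounded operator on $\ell^2(\mathbb Z^3)$ with bounded inverse, and the following hold, where $[\Gamma(z,\omega)^{-1}]_{mn}=\langle\delta_m,\Gamma(z,\omega)^{-1}\delta_n\rangle$ in the standard basis $(\delta_n)$. 1. For all $x,y\in\mathbb R^3\setminus\mathbb Z^3$ the following double series converges absolutely, and $$\Big|\sum_{m,n\in\mathbb Z^3}\overline{G_0(x,m;z)}\,[\Gamma(z,\omega)^{-1}]_{mn}\,G_0(n,y;z)\Big|\le\frac{\widetilde C}{d(x)\,d(y)}\,e^{-\widetilde\gamma\|x-y\|}.$$ 2. For all $m,n\in\mathbb Z^3$ the following integrand is integrable over $C_0\times C_0$, and $$\int_{C_0}d^3x\int_{C_0}d^3y\,\Big|\sum_{j,\ell\in\mathbb Z^3}\overline{G_0(x+m,j;z)}\,[\Gamma(z,\omega)^{-1}]_{j\ell}\,G_0(\ell,y+n;z)\Big|\le\widetilde C\,e^{-\widetilde\gamma\|n-m\|}.$$ -/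

import Mathlib

noncomputable section

namespace DeltaInteraction

/-- Three-dimensional Euclidean space, with the Euclidean norm. -/
abbrev R3 : Type := EuclideanSpace ℝ (Fin 3)

/-- The index set of the integer lattice in three dimensions. -/
abbrev Z3 : Type := Fin 3 → ℤ

/-- The point of Euclidean space given by a lattice index. -/
def pt (m : Z3) : R3 := WithLp.toLp 2 (fun i => (m i : ℝ))

/-- The integer lattice as a subset of Euclidean space. -/
def lattice : Set R3 := Set.range pt

/-- The distance of a point to the integer lattice. -/
def d (x : R3) : ℝ := Metric.infDist x lattice

/-- The closed unit cube centred at the origin. -/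
def unitCube : Set R3 := {x | ∀ i, |x i| ≤ 1 / 2}

/-- The principal branch of the complex square root. -/
def sqrtC (z : ℂ) : ℂ := z ^ (1 / 2 : ℂ)

/-- The free Green's function, the kernel of the resolvent of the nonnegative Laplacian
(meaningful for `x ≠ y`). -/
def G0 (z : ℂ) (x y : R3) : ℂ :=
  1 / (4 * (Real.pi : ℂ)) * (Complex.exp (Complex.I * sqrtC z * (‖x - y‖ : ℂ)) / (‖x - y‖ : ℂ))

/-- The diagonal parameter `e(z)`. -/
def e (z : ℂ) : ℂ := sqrtC z / (4 * (Real.pi : ℂ))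

/-- The entries of the infinite matrix `Γ(z, ω)`. -/
def gammaEntry (z : ℂ) (ω : Z3 → ℝ) (i j : Z3) : ℂ :=
  if i = j then 1 / (ω j : ℂ) - Complex.I * e z else -G0 z (pt i) (pt j)

/-- The Hilbert space of square-summable complex functions on the lattice. -/
abbrev L2Z3 : Type := lp (fun _ : Z3 => ℂ) 2

/-- The standard basis vector at the site `n`. -/
def basisVec (n : Z3) : L2Z3 := lp.single 2 n (1 : ℂ)

/-- The matrix elements of a bounded operator in the standard basis. -/
def matrixElement (A : L2Z3 →L[ℂ] L2Z3) (i j : Z3) : ℂ :=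
  inner ℂ (basisVec i) (A (basisVec j))

/-- The summand with index `p = (m, n)` of the interaction term in the Green's function,
where `B` stands for the inverse of the operator `Γ(z, ω)`. -/
def interactionSummand (z : ℂ) (B : L2Z3 →L[ℂ] L2Z3) (x y : R3) (p : Z3 × Z3) : ℂ :=
  starRingEnd ℂ (G0 z x (pt p.1)) * matrixElement B p.1 p.2 * G0 z (pt p.2) y

/-- The interaction term: the double sum over the lattice. -/
def interactionTerm (z : ℂ) (B : L2Z3 →L[ℂ] L2Z3) (x y : R3) : ℂ :=
  ∑' p : Z3 × Z3, interactionSummand z B x y p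

end DeltaInteraction

end

open MeasureTheory Set

noncomputable section

namespace DeltaInteraction

/-! Write `√z = k + iκ`; `Im z > 0` forces `k, κ > 0`. Since `1/ω_j` is real, the imaginary part of
`Γ(z, ω)` does not see `ω`: its entries are minus the values of `Im G₀` at lattice differences, and
the diagonal term `-i√z/4π` supplies exactly the limit of `Im G₀` at coinciding points
(`gammaEntry_im`).

Up to a positive constant, `Im G₀` is the Fourier transform of the positive weight `1/| |p|² - z
|²`. So the form of `-Im Γ` at a finitely supported `u` is the integral of this weight against
`|û|²`. Dropping all momenta outside one cell of the dual lattice, on which the weight has a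
positive lower bound and Parseval applies, leaves at least `c‖u‖²` with `c` depending only on `z`
(`exists_imKernel_coercive`, `exists_gamma_coercive`). Coercivity makes `Γ` invertible, with the
same `c` for every `ω`.

Decay of the inverse is a Combes–Thomas argument (`exists_inverse_decay`): conjugation by an
exponential weight changes `Γ` by an operator with zero diagonal, hence free of `ω`, and of small
norm for small `γ`, so coercivity survives. In the double series the triangle inequality turns part
of the three decaying factors into `e^{-γ‖x-y‖}`, and the rest is summed by lattice sums uniform in
the centre (`exists_tsum_exp_neg_le`). The averaged bound then follows from the pointwise one,
because `1/‖x‖` is integrable near the origin in dimension three. -/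

/-! ### The sine transform of the resolvent weight on the line. -/

/-- The exponentially damped sine, extended oddly to the real line. -/
def dampedSine (k κ t : ℝ) : ℂ := Real.exp (-κ * |t|) * Real.sin (k * t)

/-- The function `s ↦ 1 / |s² - w²|²` for `w = k + iκ`, in factorized form. -/
def resolventWeight (k κ s : ℝ) : ℝ := ((κ ^ 2 + (k - s) ^ 2) * (κ ^ 2 + (k + s) ^ 2))⁻¹

lemma resolventWeight_pos {κ : ℝ} (hκ : 0 < κ) (k s : ℝ) : 0 < resolventWeight k κ s := by
  unfold resolventWeight; positivity

lemma resolventWeight_abs (k κ s : ℝ) : resolventWeight k κ |s| = resolventWeight k κ s := by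
  rcases abs_cases s with ⟨h, _⟩ | ⟨h, _⟩ <;> rw [h]
  unfold resolventWeight
  congr 1; ring

lemma continuous_resolventWeight {κ : ℝ} (hκ : 0 < κ) (k : ℝ) :
    Continuous (resolventWeight k κ) := by
  unfold resolventWeight
  refine Continuous.inv₀ (by fun_prop) fun s => ?_
  positivity

/-- Each of the two quadratic factors dominates a multiple of `1 + s²`. Decay of order four exceeds
the dimension three, which makes the weight integrable as a radial function. -/
lemma exists_resolventWeight_le {κ : ℝ} (hκ : 0 < κ) (k : ℝ) :
    ∃ C : ℝ, ∀ s, |resolventWeight k κ s| ≤ C * (1 + |s|) ^ (-4 : ℝ) := by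
  set M : ℝ := 2 + (1 + 2 * k ^ 2) / κ ^ 2 with hM
  have hM0 : 0 < M := by positivity
  have key : ∀ s : ℝ, 1 + s ^ 2 ≤ M * (κ ^ 2 + (k - s) ^ 2) := fun s => by
    have : M * (κ ^ 2 + (k - s) ^ 2)
        = 2 * κ ^ 2 + (1 + 2 * k ^ 2) + (2 + (1 + 2 * k ^ 2) / κ ^ 2) * (k - s) ^ 2 := by
      rw [hM]; field_simp
    rw [this]
    have h2 : 0 ≤ (1 + 2 * k ^ 2) / κ ^ 2 * (k - s) ^ 2 := by positivity
    nlinarith [sq_nonneg (2 * k - s), sq_nonneg κ]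
  refine ⟨4 * M ^ 2, fun s => ?_⟩
  rw [abs_of_pos (resolventWeight_pos hκ k s)]
  have h4 : (1 + |s|) ^ (-4 : ℝ) = ((1 + |s|) ^ 4)⁻¹ := by
    rw [Real.rpow_neg (by positivity)]; norm_cast
  rw [h4, resolventWeight, ← div_eq_mul_inv, inv_eq_one_div,
    div_le_div_iff₀ (by positivity) (by positivity), one_mul]
  have h1 := key s
  have h2 := key (-s)
  rw [sub_neg_eq_add, neg_sq] at h2
  have h3 : (1 + |s|) ^ 2 ≤ 2 * (1 + s ^ 2) := by
    nlinarith [sq_nonneg (1 - |s|), sq_abs s]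
  calc (1 + |s|) ^ 4 = ((1 + |s|) ^ 2) * ((1 + |s|) ^ 2) := by ring
    _ ≤ (2 * (1 + s ^ 2)) * (2 * (1 + s ^ 2)) := by gcongr
    _ = 4 * ((1 + s ^ 2) * (1 + s ^ 2)) := by ring
    _ ≤ 4 * ((M * (κ ^ 2 + (k - s) ^ 2)) * (M * (κ ^ 2 + (k + s) ^ 2))) := by gcongr
    _ = _ := by ring

lemma continuous_dampedSine (k κ : ℝ) : Continuous (dampedSine k κ) := by
  unfold dampedSine; fun_prop

/-- With `ε = ±1` the sign of `t`, one formula in pure exponentials serves both half-lines. -/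
lemma cexp_mul_dampedSine (k κ p ε t : ℝ) (ht : |t| = ε * t) :
    Complex.exp (-(p * t : ℝ) * Complex.I) * dampedSine k κ t =
      (Complex.exp ((-(ε * κ) + (k - p) * Complex.I) * t)
        - Complex.exp ((-(ε * κ) - (k + p) * Complex.I) * t)) * (-Complex.I / 2) := by
  have h1 : (-(ε * κ) + (k - p) * Complex.I) * t =
      -(p * t : ℝ) * Complex.I + (-κ * |t| : ℝ) + (k * t) * Complex.I := by
    rw [ht]; push_cast; ring
  have h2 : (-(ε * κ) - (k + p) * Complex.I) * t =
      -(p * t : ℝ) * Complex.I + (-κ * |t| : ℝ) + -(k * t) * Complex.I := by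
    rw [ht]; push_cast; ring
  rw [h1, h2, dampedSine]
  simp only [Complex.exp_add, Complex.ofReal_exp, Complex.ofReal_sin, Complex.sin]
  push_cast
  ring

lemma integrable_dampedSine {κ : ℝ} (hκ : 0 < κ) (k : ℝ) : Integrable (dampedSine k κ) := by
  have h : ∀ ε t : ℝ, |t| = ε * t → dampedSine k κ t =
      (Complex.exp ((-(ε * κ) + (k - (0 : ℝ)) * Complex.I) * t)
        - Complex.exp ((-(ε * κ) - (k + (0 : ℝ)) * Complex.I) * t)) * (-Complex.I / 2) :=
    fun ε t ht => by rw [← cexp_mul_dampedSine k κ 0 ε t ht]; simp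
  rw [← integrableOn_univ, ← Iic_union_Ioi (a := (0 : ℝ))]
  refine IntegrableOn.union ?_ ?_
  · rw [integrableOn_congr_fun (fun t ht => h (-1) t (by rw [abs_of_nonpos ht]; ring))
      measurableSet_Iic]
    exact ((integrableOn_exp_mul_complex_Iic (by simpa) 0).sub
      (integrableOn_exp_mul_complex_Iic (by simpa) 0)).mul_const _
  · rw [integrableOn_congr_fun (fun t ht => h 1 t (by rw [abs_of_pos ht]; ring))
      measurableSet_Ioi]
    exact ((integrableOn_exp_mul_complex_Ioi (by simpa) 0).sub
      (integrableOn_exp_mul_complex_Ioi (by simpa) 0)).mul_const _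

lemma integral_cexp_mul_dampedSine {κ : ℝ} (hκ : 0 < κ) (k p : ℝ) :
    ∫ t : ℝ, Complex.exp (-(p * t : ℝ) * Complex.I) * dampedSine k κ t =
      -(4 * k * κ * (p * resolventWeight k κ p) : ℝ) * Complex.I := by
  have hint : Integrable fun t : ℝ =>
      Complex.exp (-(p * t : ℝ) * Complex.I) * dampedSine k κ t := by
    refine (integrable_dampedSine hκ k).bdd_mul (c := 1) (by fun_prop) (.of_forall fun t => ?_)
    rw [← Complex.ofReal_neg, Complex.norm_exp_ofReal_mul_I]
  rw [← integral_add_compl (measurableSet_Iic (a := (0 : ℝ))) hint, compl_Iic]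
  rw [setIntegral_congr_fun measurableSet_Iic fun t ht =>
      cexp_mul_dampedSine k κ p (-1) t (by rw [abs_of_nonpos ht]; ring),
    setIntegral_congr_fun measurableSet_Ioi fun t ht =>
      cexp_mul_dampedSine k κ p 1 t (by rw [abs_of_pos ht]; ring)]
  rw [integral_mul_const, integral_mul_const, integral_sub, integral_sub,
    integral_exp_mul_complex_Iic, integral_exp_mul_complex_Iic,
    integral_exp_mul_complex_Ioi, integral_exp_mul_complex_Ioi]
  rotate_left
  · simpa
  · simpa
  · simpa
  · simpa
  · exact integrableOn_exp_mul_complex_Ioi (by simpa) 0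
  · exact integrableOn_exp_mul_complex_Ioi (by simpa) 0
  · exact integrableOn_exp_mul_complex_Iic (by simpa) 0
  · exact integrableOn_exp_mul_complex_Iic (by simpa) 0
  have hne : ∀ (ε : ℝ) (a : ℝ), ε ≠ 0 → (ε * κ + a * Complex.I : ℂ) ≠ 0 := fun ε a hε h => by
    have := congrArg Complex.re h
    simp [hε, hκ.ne'] at this
  have e1 := hne 1 (k - p) one_ne_zero
  have e2 := hne 1 (-(k + p)) one_ne_zero
  have e3 := hne (-1) (k - p) (by norm_num)
  have e4 := hne (-1) (-(k + p)) (by norm_num)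
  have n1 : ((κ ^ 2 + (k - p) ^ 2 : ℝ) : ℂ) ≠ 0 := by
    exact_mod_cast (by positivity : κ ^ 2 + (k - p) ^ 2 ≠ 0)
  have n2 : ((κ ^ 2 + (k + p) ^ 2 : ℝ) : ℂ) ≠ 0 := by
    exact_mod_cast (by positivity : κ ^ 2 + (k + p) ^ 2 ≠ 0)
  simp only [resolventWeight, Complex.ofReal_zero, mul_zero, Complex.exp_zero]
  push_cast at e1 e2 e3 e4 n1 n2 ⊢
  simp only [neg_mul, one_mul, neg_neg, ← sub_eq_add_neg] at e1 e2 e3 e4 ⊢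
  have hI : Complex.I ^ 2 = -1 := Complex.I_sq
  have f1 : 1 / (κ + (k - p) * Complex.I) = (κ - (k - p) * Complex.I) / (κ ^ 2 + (k - p) ^ 2) := by
    rw [div_eq_div_iff e1 n1]; linear_combination (k - p : ℂ) ^ 2 * hI
  have f2 : 1 / (κ - (k + p) * Complex.I) = (κ + (k + p) * Complex.I) / (κ ^ 2 + (k + p) ^ 2) := by
    rw [div_eq_div_iff e2 n2]; linear_combination (k + p : ℂ) ^ 2 * hI
  have f3 : -1 / (-κ + (k - p) * Complex.I) =
      (κ + (k - p) * Complex.I) / (κ ^ 2 + (k - p) ^ 2) := by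
    rw [div_eq_div_iff e3 n1]; linear_combination -(k - p : ℂ) ^ 2 * hI
  have f4 : -1 / (-κ - (k + p) * Complex.I) =
      (κ - (k + p) * Complex.I) / (κ ^ 2 + (k + p) ^ 2) := by
    rw [div_eq_div_iff e4 n2]; linear_combination -(k + p : ℂ) ^ 2 * hI
  -- The real parts of the four fractions cancel, as they must for the transform of an odd real
  -- function.
  rw [f1, f2, f3, f4]
  field_simp
  ring

lemma integrable_mul_resolventWeight {κ : ℝ} (hκ : 0 < κ) (k : ℝ) :
    Integrable fun p : ℝ => p * resolventWeight k κ p := by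
  obtain ⟨C, hC⟩ := exists_resolventWeight_le hκ k
  have h : Integrable fun p : ℝ => C * (1 + ‖p‖) ^ (-3 : ℝ) :=
    (integrable_one_add_norm (by simp)).const_mul C
  refine h.mono' ((continuous_id.mul (continuous_resolventWeight hκ k)).aestronglyMeasurable)
    (.of_forall fun p => ?_)
  have h1 : (1 + |p|) ^ (-3 : ℝ) = (1 + |p|) * (1 + |p|) ^ (-4 : ℝ) := by
    rw [← Real.rpow_one_add' (by positivity) (by norm_num)]; norm_num
  rw [Real.norm_eq_abs, Real.norm_eq_abs, abs_mul, h1]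
  calc |p| * |resolventWeight k κ p| ≤ (1 + |p|) * (C * (1 + |p|) ^ (-4 : ℝ)) := by
        gcongr
        · linarith
        · exact hC p
    _ = _ := by ring

/-- Fourier inversion for the damped sine: its sine transform. -/
lemma integral_mul_resolventWeight_mul_sin {κ k : ℝ} (hκ : 0 < κ) (hk : 0 < k) {r : ℝ}
    (hr : 0 ≤ r) :
    ∫ s in Ioi (0 : ℝ), s * resolventWeight k κ s * Real.sin (r * s) =
      Real.pi / (4 * k * κ) * (Real.exp (-κ * r) * Real.sin (k * r)) := by
  set f := dampedSine k κ
  have hF : ∀ w : ℝ, FourierTransform.fourier f w =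
      -(4 * k * κ * (2 * Real.pi * w * resolventWeight k κ (2 * Real.pi * w)) : ℝ)
        * Complex.I := fun w => by
    rw [Real.fourier_real_eq_integral_exp_smul, ← integral_cexp_mul_dampedSine hκ]
    refine integral_congr_ae (.of_forall fun t => ?_)
    simp only [smul_eq_mul]
    congr 3
    push_cast; ring
  have hFi : Integrable (FourierTransform.fourier f) := by
    rw [funext hF]
    refine Integrable.mul_const ?_ _
    have := (((integrable_mul_resolventWeight hκ k).comp_mul_left'
      (R := 2 * Real.pi) (by positivity)).const_mul (4 * k * κ)).ofReal (𝕜 := ℂ)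
    exact this.neg
  have hinv := congrFun ((continuous_dampedSine k κ).fourierInv_fourier_eq
    (integrable_dampedSine hκ k) hFi) r
  rw [Real.fourierInv_eq'] at hinv
  have hre := congrArg Complex.re hinv
  rw [← Complex.reCLM_apply, ← ContinuousLinearMap.integral_comp_comm] at hre
  swap
  · refine Integrable.bdd_mul (c := 1) hFi (by fun_prop) (.of_forall fun t => ?_)
    rw [Complex.norm_exp_ofReal_mul_I]
  -- The real part of the integrand is even; writing it through `|p|` lets the line be folded onto
  -- the half-line.
  have hg : ∀ v : ℝ, Complex.reCLM (Complex.exp ((2 * Real.pi * inner ℝ v r : ℝ) * Complex.I) •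
      FourierTransform.fourier f v) =
      (fun p : ℝ => 4 * k * κ * (|p| * resolventWeight k κ |p| * Real.sin (r * |p|)))
        (2 * Real.pi * v) := fun v => by
    have habs : |2 * Real.pi * v| * Real.sin (r * |2 * Real.pi * v|) =
        (2 * Real.pi * v) * Real.sin (r * (2 * Real.pi * v)) := by
      rcases abs_cases (2 * Real.pi * v) with ⟨h, _⟩ | ⟨h, _⟩ <;> rw [h]
      rw [mul_neg, Real.sin_neg]; ring
    have : 4 * k * κ * (|2 * Real.pi * v| * resolventWeight k κ |2 * Real.pi * v| *
        Real.sin (r * |2 * Real.pi * v|)) = 4 * k * κ * (2 * Real.pi * v) *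
          resolventWeight k κ (2 * Real.pi * v) * Real.sin (r * (2 * Real.pi * v)) := by
      rw [resolventWeight_abs]
      linear_combination 4 * k * κ * resolventWeight k κ (2 * Real.pi * v) * habs
    simp only [this]
    rw [hF, Complex.reCLM_apply, smul_eq_mul, Complex.exp_mul_I, ← Complex.ofReal_cos,
      ← Complex.ofReal_sin]
    have hin : inner ℝ v r = r * v := by simp
    have h2 : 2 * Real.pi * (r * v) = r * (2 * Real.pi * v) := by ring
    rw [hin, h2]
    simp only [Complex.mul_re, Complex.add_re, Complex.mul_im, Complex.add_im, Complex.neg_re,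
      Complex.neg_im, Complex.ofReal_re, Complex.ofReal_im, Complex.I_re, Complex.I_im]
    ring
  rw [integral_congr_ae (.of_forall hg), Measure.integral_comp_mul_left
      (fun p : ℝ => 4 * k * κ * (|p| * resolventWeight k κ |p| * Real.sin (r * |p|))), integral_const_mul,
    integral_comp_abs (f := fun p : ℝ => p * resolventWeight k κ p * Real.sin (r * p)),
    dampedSine, abs_of_nonneg hr, abs_of_pos (by positivity), smul_eq_mul,
    ← Complex.ofReal_mul, Complex.ofReal_re] at hre
  rw [← hre]
  generalize ∫ s in Ioi (0 : ℝ), s * resolventWeight k κ s * Real.sin (r * s) = J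
  field_simp

/-! ### Fourier transforms of radial functions in three dimensions. -/

/-- The angular integral of polar coordinates in a plane containing the axis. The circle is covered
in full, so the value is twice that over `[0, π]`, where `sin θ` times the exponential has an
elementary primitive. -/
lemma integral_abs_sin_mul_cexp_cos {a : ℝ} (ha : a ≠ 0) :
    ∫ θ in Ioo (-Real.pi) Real.pi,
      ((|Real.sin θ| : ℝ) : ℂ) * Complex.exp ((a * Real.cos θ : ℝ) * Complex.I) =
      (4 * Real.sin a / a : ℝ) := by
  have hc : Continuous fun θ : ℝ =>
      ((|Real.sin θ| : ℝ) : ℂ) * Complex.exp ((a * Real.cos θ : ℝ) * Complex.I) := by fun_prop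
  have hpos : ∫ θ in (0 : ℝ)..Real.pi,
      ((|Real.sin θ| : ℝ) : ℂ) * Complex.exp ((a * Real.cos θ : ℝ) * Complex.I) =
      (2 * Real.sin a / a : ℝ) := by
    have hcongr : ∀ θ ∈ uIcc 0 Real.pi,
        ((|Real.sin θ| : ℝ) : ℂ) * Complex.exp ((a * Real.cos θ : ℝ) * Complex.I) =
        Real.sin θ * Complex.exp ((a * Real.cos θ : ℝ) * Complex.I) := fun θ hθ => by
      rw [uIcc_of_le Real.pi_pos.le] at hθ
      rw [abs_of_nonneg (Real.sin_nonneg_of_mem_Icc hθ)]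
    rw [intervalIntegral.integral_congr hcongr]
    have haC : (a : ℂ) ≠ 0 := by exact_mod_cast ha
    have hder : ∀ θ ∈ uIcc 0 Real.pi, HasDerivAt
        (fun θ : ℝ => Complex.I / a * Complex.exp ((a * Real.cos θ : ℝ) * Complex.I))
        (Real.sin θ * Complex.exp ((a * Real.cos θ : ℝ) * Complex.I)) θ := fun θ _ => by
      have h1 : HasDerivAt (fun θ : ℝ => ((a * Real.cos θ : ℝ) : ℂ) * Complex.I)
          (((a * -Real.sin θ : ℝ) : ℂ) * Complex.I) θ :=
        (((Real.hasDerivAt_cos θ).const_mul a).ofReal_comp).mul_const _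
      refine ((h1.cexp).const_mul (Complex.I / a)).congr_deriv ?_
      push_cast
      linear_combination -(Complex.exp (a * Complex.cos θ * Complex.I) * Complex.sin θ)
        * (Complex.I_sq + Complex.I * div_mul_cancel₀ Complex.I haC)
    rw [intervalIntegral.integral_eq_sub_of_hasDerivAt hder
      (Continuous.intervalIntegrable (by fun_prop) _ _)]
    simp only [Real.cos_pi, Real.cos_zero, mul_one, mul_neg]
    push_cast
    rw [Complex.sin]
    field_simp
  have hneg : ∫ θ in (-Real.pi)..0,
      ((|Real.sin θ| : ℝ) : ℂ) * Complex.exp ((a * Real.cos θ : ℝ) * Complex.I) =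
      (2 * Real.sin a / a : ℝ) := by
    rw [← hpos]
    have := intervalIntegral.integral_comp_neg (a := 0) (b := Real.pi) fun θ : ℝ =>
      ((|Real.sin θ| : ℝ) : ℂ) * Complex.exp ((a * Real.cos θ : ℝ) * Complex.I)
    simpa using this.symm
  rw [← integral_Ioc_eq_integral_Ioo, ← intervalIntegral.integral_of_le (by linarith [Real.pi_pos]),
    ← intervalIntegral.integral_add_adjacent_intervals (b := 0)
      (hc.intervalIntegrable _ _) (hc.intervalIntegrable _ _), hpos, hneg, ← Complex.ofReal_add]
  congr 1; ring

/-- A linear isometry moving a vector of Euclidean space to the first coordinate axis. -/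
lemma exists_linearIsometryEquiv_axis (x : R3) :
    ∃ U : R3 ≃ₗᵢ[ℝ] R3, ∀ p, inner ℝ (U p) x = ‖x‖ * p 0 := by
  set v : R3 := EuclideanSpace.single 0 ‖x‖ with hv
  have hn : ‖v‖ = ‖x‖ := by simp [hv]
  -- The reflection exchanging the equally long vectors `v` and `x`.
  refine ⟨(Submodule.span ℝ {v - x})ᗮ.reflection, fun p => ?_⟩
  have h := Submodule.reflection_sub hn
  have h2 : inner ℝ ((Submodule.span ℝ {v - x})ᗮ.reflection p)
      ((Submodule.span ℝ {v - x})ᗮ.reflection v) = inner ℝ p v :=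
    LinearIsometryEquiv.inner_map_map _ _ _
  rw [h] at h2
  rw [h2, hv, EuclideanSpace.inner_single_right]
  simp

/-- Splitting three-dimensional space as a line times a plane. -/
lemma exists_measurePreserving_line_prod_plane :
    ∃ T : R3 ≃ᵐ ℝ × (ℝ × ℝ), MeasurePreserving T ∧
      ∀ p, (T p).1 = p 0 ∧ ‖p‖ = √((T p).1 ^ 2 + ((T p).2.1 ^ 2 + (T p).2.2 ^ 2)) := by
  have h1 := PiLp.volume_preserving_ofLp (Fin 3)
  have h2 := volume_preserving_piFinSuccAbove (fun _ : Fin 3 => ℝ) 0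
  have h3 := volume_preserving_finTwoArrow ℝ
  have h4 := (MeasurePreserving.id (volume : Measure ℝ)).prod h3
  refine ⟨((MeasurableEquiv.toLp 2 (Fin 3 → ℝ)).symm.trans
    (MeasurableEquiv.piFinSuccAbove (fun _ : Fin 3 => ℝ) 0)).trans
      ((MeasurableEquiv.refl ℝ).prodCongr MeasurableEquiv.finTwoArrow), ?_, fun p => ⟨rfl, ?_⟩⟩
  · exact h4.comp (h2.comp h1)
  · rw [EuclideanSpace.norm_eq, Fin.sum_univ_three]
    simp only [Real.norm_eq_abs, sq_abs]
    rw [add_assoc]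
    rfl

section Radial

variable {F : ℝ → ℝ} {C : ℝ}

lemma one_add_rpow_neg_le_of_le {C : ℝ} {g : ℝ} {s t : ℝ} (r : ℝ) (hr : 0 ≤ r) (ht : 0 ≤ t)
    (hts : t ≤ |s|) (hg : |g| ≤ C * (1 + |s|) ^ (-r)) : |g| ≤ C * (1 + t) ^ (-r) := by
  have hC : 0 ≤ C := by
    by_contra hC
    have : C * (1 + |s|) ^ (-r) < 0 := mul_neg_of_neg_of_pos (not_le.1 hC) (by positivity)
    linarith [abs_nonneg g]
  refine hg.trans (mul_le_mul_of_nonneg_left ?_ hC)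
  exact Real.rpow_le_rpow_of_nonpos (by positivity) (by linarith) (by linarith)

lemma integrable_radial (hFc : Continuous F) (hF : ∀ s, |F s| ≤ C * (1 + |s|) ^ (-4 : ℝ)) :
    Integrable fun p : R3 => F ‖p‖ := by
  refine ((integrable_one_add_norm (E := R3) (μ := volume) (r := 4)
    (by simp; norm_num)).const_mul C).mono' (by fun_prop) (.of_forall fun p => ?_)
  simpa using hF ‖p‖

lemma abs_mul_weight_le (hF : ∀ s, |F s| ≤ C * (1 + |s|) ^ (-4 : ℝ)) (s : ℝ) :
    |s * F s| ≤ C * (1 + |s|) ^ (-3 : ℝ) := by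
  have h1 : (1 + |s|) ^ (-3 : ℝ) = (1 + |s|) * (1 + |s|) ^ (-4 : ℝ) := by
    rw [← Real.rpow_one_add' (by positivity) (by norm_num)]; norm_num
  rw [abs_mul, h1]
  calc |s| * |F s| ≤ (1 + |s|) * (C * (1 + |s|) ^ (-4 : ℝ)) := by
        gcongr
        · linarith
        · exact hF s
    _ = _ := by ring

lemma abs_sq_mul_weight_le (hF : ∀ s, |F s| ≤ C * (1 + |s|) ^ (-4 : ℝ)) (s : ℝ) :
    |s ^ 2 * F s| ≤ C * (1 + |s|) ^ (-2 : ℝ) := by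
  have h1 : (1 + |s|) ^ (-2 : ℝ) = (1 + |s|) * (1 + |s|) ^ (-3 : ℝ) := by
    rw [← Real.rpow_one_add' (by positivity) (by norm_num)]; norm_num
  rw [pow_two, mul_assoc, abs_mul, h1]
  calc |s| * |s * F s| ≤ (1 + |s|) * (C * (1 + |s|) ^ (-3 : ℝ)) := by
        gcongr
        · linarith
        · exact abs_mul_weight_le hF s
    _ = _ := by ring

/-- Writing `2π ∫_{ρ>0}` as `π ∫ |ρ|` over the whole line turns `ρ` into a Cartesian coordinate. The
pair `(q, ρ)` then ranges over a plane, where polar coordinates apply again; two planar passages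
replace spherical coordinates. -/
lemma integral_plane_radial (q : ℝ) :
    ∫ y : ℝ × ℝ, F (√(q ^ 2 + (y.1 ^ 2 + y.2 ^ 2))) =
      Real.pi * ∫ ρ : ℝ, |ρ| * F (√(q ^ 2 + ρ ^ 2)) := by
  rw [← integral_comp_polarCoord_symm, polarCoord_target]
  have h : ∀ p ∈ Ioi (0 : ℝ) ×ˢ Ioo (-Real.pi) Real.pi,
      p.1 • F (√(q ^ 2 + ((polarCoord.symm p).1 ^ 2 + (polarCoord.symm p).2 ^ 2))) =
      (fun ρ => |ρ| * F (√(q ^ 2 + |ρ| ^ 2))) p.1 * (fun _ => (1 : ℝ)) p.2 := fun p hp => by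
    have : (polarCoord.symm p).1 ^ 2 + (polarCoord.symm p).2 ^ 2 = p.1 ^ 2 := by
      rw [polarCoord_symm_apply]
      linear_combination p.1 ^ 2 * Real.sin_sq_add_cos_sq p.2
    simp only [this, smul_eq_mul, mul_one, sq_abs]
    rw [abs_of_pos hp.1]
  rw [setIntegral_congr_fun (measurableSet_Ioi.prod measurableSet_Ioo) h, Measure.volume_eq_prod,
    setIntegral_prod_mul (fun ρ => |ρ| * F (√(q ^ 2 + |ρ| ^ 2))) (fun _ => (1 : ℝ))]
  have h2 : ∀ ρ : ℝ, |ρ| * F (√(q ^ 2 + ρ ^ 2)) =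
      (fun ρ => |ρ| * F (√(q ^ 2 + ρ ^ 2))) |ρ| := fun ρ => by simp
  rw [integral_congr_ae (.of_forall h2),
    integral_comp_abs (f := fun ρ => |ρ| * F (√(q ^ 2 + ρ ^ 2)))]
  simp only [sq_abs, integral_const, MeasurableSet.univ, measureReal_restrict_apply, univ_inter,
    Real.volume_real_Ioo_of_le (show -Real.pi ≤ Real.pi by linarith [Real.pi_pos]), smul_eq_mul]
  ring

lemma integral_halfplane_radial (hFc : Continuous F)
    (hF : ∀ s, |F s| ≤ C * (1 + |s|) ^ (-4 : ℝ)) {r : ℝ} (hr : 0 < r) :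
    ∫ y : ℝ × ℝ, ((|y.2| * F (√(y.1 ^ 2 + y.2 ^ 2)) : ℝ) : ℂ)
        * Complex.exp ((r * y.1 : ℝ) * Complex.I) =
      (4 / r * ∫ s in Ioi (0 : ℝ), s * F s * Real.sin (r * s) : ℝ) := by
  rw [← integral_comp_polarCoord_symm, polarCoord_target]
  have h : ∀ p ∈ Ioi (0 : ℝ) ×ˢ Ioo (-Real.pi) Real.pi,
      p.1 • (((|(polarCoord.symm p).2| *
          F (√((polarCoord.symm p).1 ^ 2 + (polarCoord.symm p).2 ^ 2)) : ℝ) : ℂ)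
        * Complex.exp ((r * (polarCoord.symm p).1 : ℝ) * Complex.I)) =
      ((p.1 ^ 2 * F p.1 : ℝ) : ℂ) * (((|Real.sin p.2| : ℝ) : ℂ) *
        Complex.exp (((r * p.1) * Real.cos p.2 : ℝ) * Complex.I)) := fun p hp => by
    have h1 : (polarCoord.symm p).1 ^ 2 + (polarCoord.symm p).2 ^ 2 = p.1 ^ 2 := by
      rw [polarCoord_symm_apply]
      linear_combination p.1 ^ 2 * Real.sin_sq_add_cos_sq p.2
    have hp1 : 0 < p.1 := hp.1
    rw [h1, Real.sqrt_sq hp1.le, polarCoord_symm_apply, abs_mul, abs_of_pos hp1, ← mul_assoc r,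
      Complex.real_smul]
    push_cast
    ring
  rw [setIntegral_congr_fun (measurableSet_Ioi.prod measurableSet_Ioo) h, Measure.volume_eq_prod,
    setIntegral_prod]
  · have h3 : ∀ s ∈ Ioi (0 : ℝ), ∫ θ in Ioo (-Real.pi) Real.pi,
        ((s ^ 2 * F s : ℝ) : ℂ) * (((|Real.sin θ| : ℝ) : ℂ) *
        Complex.exp (((r * s) * Real.cos θ : ℝ) * Complex.I)) =
        ((4 / r * (s * F s * Real.sin (r * s)) : ℝ) : ℂ) := fun s hs => by
      have hs' : s ≠ 0 := ne_of_gt hs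
      rw [integral_const_mul, integral_abs_sin_mul_cexp_cos (by positivity), ← Complex.ofReal_mul]
      congr 1
      field_simp
    rw [setIntegral_congr_fun measurableSet_Ioi h3, integral_complex_ofReal, integral_const_mul]
  · have hi : Integrable (fun s : ℝ => s ^ 2 * F s) := by
      refine ((integrable_one_add_norm (E := ℝ) (μ := volume) (r := 2)
        (by simp)).const_mul C).mono' (by fun_prop) (.of_forall fun p => ?_)
      simpa using abs_sq_mul_weight_le hF p
    have hc : Integrable (fun _ : ℝ => (1 : ℂ)) (volume.restrict (Ioo (-Real.pi) Real.pi)) := by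
      simp
    have hprod := (hi.ofReal (𝕜 := ℂ)).restrict (s := Ioi 0) |>.mul_prod hc
    rw [IntegrableOn, ← Measure.prod_restrict]
    refine hprod.mono (by fun_prop) (.of_forall fun p => ?_)
    rw [norm_mul, norm_mul, norm_mul, norm_one]
    refine mul_le_mul_of_nonneg_left ?_ (norm_nonneg _)
    rw [Complex.norm_exp_ofReal_mul_I, mul_one, Complex.norm_real, norm_abs_eq_norm,
      Real.norm_eq_abs]
    exact Real.abs_sin_le_one _

/-- The Fourier transform of a radial function on three-dimensional space is a sine transform. -/
lemma integral_radial_mul_cexp_inner (hFc : Continuous F)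
    (hF : ∀ s, |F s| ≤ C * (1 + |s|) ^ (-4 : ℝ)) {x : R3} (hx : x ≠ 0) :
    ∫ p : R3, (F ‖p‖ : ℂ) * Complex.exp ((inner ℝ p x : ℝ) * Complex.I) =
      (4 * Real.pi / ‖x‖ * ∫ s in Ioi (0 : ℝ), s * F s * Real.sin (‖x‖ * s) : ℝ) := by
  have hr : 0 < ‖x‖ := norm_pos_iff.2 hx
  obtain ⟨U, hU⟩ := exists_linearIsometryEquiv_axis x
  obtain ⟨T, hT, hTp⟩ := exists_measurePreserving_line_prod_plane
  set r := ‖x‖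
  let g : ℝ × (ℝ × ℝ) → ℂ := fun w =>
    (F (√(w.1 ^ 2 + (w.2.1 ^ 2 + w.2.2 ^ 2))) : ℂ) * Complex.exp ((r * w.1 : ℝ) * Complex.I)
  have hgT : ∀ p : R3, (F ‖U p‖ : ℂ) * Complex.exp ((inner ℝ (U p) x : ℝ) * Complex.I)
      = g (T p) := fun p => by
    simp only [g]
    rw [hU, LinearIsometryEquiv.norm_map, ← (hTp p).2, (hTp p).1]
  have hint : Integrable g := by
    rw [← hT.integrable_comp_emb T.measurableEmbedding]
    refine Integrable.congr ?_ (.of_forall hgT)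
    have : Integrable fun p : R3 =>
        (F ‖p‖ : ℂ) * Complex.exp ((inner ℝ p x : ℝ) * Complex.I) := by
      refine ((integrable_radial hFc hF).ofReal (𝕜 := ℂ)).mul_bdd (c := 1) (by fun_prop)
        (.of_forall fun p => ?_)
      rw [Complex.norm_exp_ofReal_mul_I]
    exact (U.measurePreserving.integrable_comp_emb
      U.toHomeomorph.toMeasurableEquiv.measurableEmbedding).2 this
  rw [← U.measurePreserving.integral_comp U.toHomeomorph.toMeasurableEquiv.measurableEmbedding,
    integral_congr_ae (.of_forall hgT), hT.integral_comp T.measurableEmbedding g,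
    Measure.volume_eq_prod, integral_prod _ hint]
  have hinner : ∀ q : ℝ, ∫ y : ℝ × ℝ, g (q, y) = ((Real.pi : ℝ) : ℂ) * ∫ ρ : ℝ,
      ((|ρ| * F (√(q ^ 2 + ρ ^ 2)) : ℝ) : ℂ) * Complex.exp ((r * q : ℝ) * Complex.I) := fun q => by
    simp only [g]
    rw [integral_mul_const, integral_complex_ofReal, integral_plane_radial, integral_mul_const,
      integral_complex_ofReal]
    push_cast
    ring
  -- Fubini is now read backwards: the axial variable `q` and the radius `ρ` become the two
  -- coordinates of one plane.
  rw [integral_congr_ae (.of_forall hinner), integral_const_mul,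
    ← integral_prod (fun y : ℝ × ℝ => ((|y.2| * F (√(y.1 ^ 2 + y.2 ^ 2)) : ℝ) : ℂ)
        * Complex.exp ((r * y.1 : ℝ) * Complex.I)), ← Measure.volume_eq_prod,
    integral_halfplane_radial hFc hF hr]
  · rw [← Complex.ofReal_mul]
    congr 1
    ring
  · have hi : Integrable (fun y : ℝ × ℝ => |y.2| * F (√(y.1 ^ 2 + y.2 ^ 2))) := by
      refine ((integrable_one_add_norm (E := ℝ × ℝ) (μ := volume) (r := 3)
        (by simp; norm_num)).const_mul C).mono' (by fun_prop) (.of_forall fun y => ?_)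
      have h1 : |y.2| ≤ √(y.1 ^ 2 + y.2 ^ 2) := Real.abs_le_sqrt (by nlinarith [sq_nonneg y.1])
      have h2 : |y.1| ≤ √(y.1 ^ 2 + y.2 ^ 2) := Real.abs_le_sqrt (by nlinarith [sq_nonneg y.2])
      have h3 := abs_mul_weight_le hF (√(y.1 ^ 2 + y.2 ^ 2))
      -- The norm on `ℝ × ℝ` is the maximum norm, which the Euclidean length dominates.
      have h4 : ‖y‖ ≤ |√(y.1 ^ 2 + y.2 ^ 2)| := by
        rw [abs_of_nonneg (Real.sqrt_nonneg _)]
        exact max_le h2 h1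
      have h5 := one_add_rpow_neg_le_of_le 3 (by norm_num) (norm_nonneg y) h4 h3
      refine le_trans ?_ h5
      rw [Real.norm_eq_abs, abs_mul, abs_mul, abs_abs]
      exact mul_le_mul_of_nonneg_right (h1.trans (le_abs_self _)) (abs_nonneg _)
    refine (hi.ofReal (𝕜 := ℂ)).mul_bdd (c := 1) (by fun_prop) (.of_forall fun p => ?_)
    rw [Complex.norm_exp_ofReal_mul_I]

end Radial

/-! ### Fourier representation of the imaginary part of the Green's function. -/

/-- The imaginary part of the free Green's function at spectral parameter `(k + iκ)²`, as a
function of the difference variable, extended continuously to the origin. -/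
def imKernel (k κ : ℝ) (x : R3) : ℝ :=
  if x = 0 then k / (4 * Real.pi) else
    Real.exp (-κ * ‖x‖) * Real.sin (k * ‖x‖) / (4 * Real.pi * ‖x‖)

lemma integrable_resolventWeight_mul_cexp {κ : ℝ} (hκ : 0 < κ) (k : ℝ) (x : R3) :
    Integrable fun p : R3 =>
      (resolventWeight k κ ‖p‖ : ℂ) * Complex.exp ((inner ℝ p x : ℝ) * Complex.I) := by
  obtain ⟨C, hC⟩ := exists_resolventWeight_le hκ k
  have hc := continuous_resolventWeight hκ k
  refine ((integrable_radial hc hC).ofReal (𝕜 := ℂ)).mul_bdd (c := 1) (by fun_prop)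
    (.of_forall fun p => ?_)
  rw [Complex.norm_exp_ofReal_mul_I]

lemma imKernel_of_ne_zero {k κ : ℝ} (hk : 0 < k) (hκ : 0 < κ) {x : R3} (hx : x ≠ 0) :
    ((k * κ / (4 * Real.pi ^ 3) : ℝ) : ℂ) * ∫ p : R3, (resolventWeight k κ ‖p‖ : ℂ) *
      Complex.exp ((inner ℝ p x : ℝ) * Complex.I) = imKernel k κ x := by
  obtain ⟨C, hC⟩ := exists_resolventWeight_le hκ k
  have hr : ‖x‖ ≠ 0 := norm_ne_zero_iff.2 hx
  rw [integral_radial_mul_cexp_inner (continuous_resolventWeight hκ k) hC hx,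
    integral_mul_resolventWeight_mul_sin hκ hk (norm_nonneg x), ← Complex.ofReal_mul, imKernel,
    if_neg hx]
  congr 1
  have := Real.pi_ne_zero
  field_simp

/-- The Fourier representation of the imaginary part of the free Green's function. -/
lemma integral_resolventWeight_mul_cexp {k κ : ℝ} (hk : 0 < k) (hκ : 0 < κ) (x : R3) :
    ((k * κ / (4 * Real.pi ^ 3) : ℝ) : ℂ) * ∫ p : R3, (resolventWeight k κ ‖p‖ : ℂ) *
      Complex.exp ((inner ℝ p x : ℝ) * Complex.I) = imKernel k κ x := by
  by_cases hx : x = 0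
  swap
  · exact imKernel_of_ne_zero hk hκ hx
  subst hx
  obtain ⟨C, hC⟩ := exists_resolventWeight_le hκ k
  have hc := continuous_resolventWeight hκ k
  have hcont : Continuous fun x : R3 => ((k * κ / (4 * Real.pi ^ 3) : ℝ) : ℂ) *
      ∫ p : R3, (resolventWeight k κ ‖p‖ : ℂ) *
        Complex.exp ((inner ℝ p x : ℝ) * Complex.I) := by
    refine continuous_const.mul (continuous_of_dominated
      (bound := fun p => ‖(resolventWeight k κ ‖p‖ : ℂ)‖) (fun x => by fun_prop)
      (fun x => .of_forall fun p => ?_) ((integrable_radial hc hC).ofReal (𝕜 := ℂ)).norm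
      (.of_forall fun p => by fun_prop))
    rw [norm_mul, Complex.norm_exp_ofReal_mul_I, mul_one]
  set v : R3 := EuclideanSpace.single 0 1 with hv
  have hvn : ‖v‖ = 1 := by simp [hv]
  have hv0 : Filter.Tendsto (fun t : ℝ => t • v) (nhdsWithin 0 (Ioi 0)) (nhds 0) := by
    have : Continuous fun t : ℝ => t • v := by fun_prop
    simpa using (this.tendsto 0).mono_left nhdsWithin_le_nhds
  -- The value at the origin is the limit along a ray: the left side is continuous, and the kernel
  -- tends to the derivative of `e^{-κt} sin(kt)` at `0`, divided by `4π`.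
  refine tendsto_nhds_unique ((hcont.tendsto 0).comp hv0) ?_
  have hder : HasDerivAt (fun t : ℝ => Real.exp (-κ * t) * Real.sin (k * t)) k 0 := by
    have h1 := (((hasDerivAt_id (0 : ℝ)).const_mul (-κ)).exp).mul
      (((hasDerivAt_id (0 : ℝ)).const_mul k).sin)
    refine h1.congr_deriv ?_
    simp
  have hs := (hasDerivAt_iff_tendsto_slope_zero.1 hder).mono_left
    (nhdsWithin_mono 0 (fun t ht => ne_of_gt ht : Ioi (0 : ℝ) ⊆ {0}ᶜ))
  have hs2 := (Complex.continuous_ofReal.tendsto _).comp (hs.div_const (4 * Real.pi))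
  rw [imKernel, if_pos rfl]
  refine hs2.congr' ?_
  filter_upwards [self_mem_nhdsWithin] with t (ht : 0 < t)
  have hn : ‖t • v‖ = t := by rw [norm_smul, hvn, mul_one, Real.norm_of_nonneg ht.le]
  have hne : t • v ≠ 0 := by rw [← norm_pos_iff, hn]; exact ht
  simp only [Function.comp_apply]
  rw [imKernel_of_ne_zero hk hκ hne, imKernel, if_neg hne, hn]
  congr 1
  simp only [zero_add, mul_zero, Real.sin_zero, sub_zero, smul_eq_mul]
  field_simp

/-! ### Parseval on the dual cell and coercivity of the kernel. -/

lemma integral_cexp_int_mul (n : ℤ) :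
    ∫ t in Icc (-Real.pi) Real.pi, Complex.exp ((t * n : ℝ) * Complex.I) =
      if n = 0 then ((2 * Real.pi : ℝ) : ℂ) else 0 := by
  rw [integral_Icc_eq_integral_Ioc,
    ← intervalIntegral.integral_of_le (by linarith [Real.pi_pos])]
  split_ifs with h
  · subst h
    simp only [Int.cast_zero, mul_zero, Complex.ofReal_zero, zero_mul, Complex.exp_zero,
      intervalIntegral.integral_const, Complex.real_smul, mul_one]
    congr 1; ring
  · have hn : (n * Complex.I : ℂ) ≠ 0 := mul_ne_zero (by exact_mod_cast h) Complex.I_ne_zero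
    have h1 : ∀ t : ℝ, Complex.exp ((t * n : ℝ) * Complex.I) =
        Complex.exp ((n * Complex.I) * t) := fun t => by
      congr 1; push_cast; ring
    simp only [h1]
    rw [integral_exp_mul_complex hn, div_eq_zero_iff]
    left
    rw [sub_eq_zero, Complex.exp_eq_exp_iff_exists_int]
    exact ⟨n, by push_cast; ring⟩

/-- The fundamental cell of the dual lattice. -/
def dualCell : Set R3 := {p | ∀ i, p i ∈ Icc (-Real.pi) Real.pi}

lemma dualCell_eq_preimage : dualCell =
    WithLp.ofLp ⁻¹' (univ.pi fun _ : Fin 3 => Icc (-Real.pi) Real.pi) := by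
  ext p; simp only [dualCell, mem_preimage, mem_univ_pi]; rfl

lemma measurableSet_dualCell : MeasurableSet dualCell := by
  rw [dualCell_eq_preimage]
  exact (MeasurableSet.univ_pi fun _ => measurableSet_Icc).preimage (by fun_prop)

lemma norm_le_of_mem_dualCell {p : R3} (hp : p ∈ dualCell) : ‖p‖ ≤ 2 * Real.pi := by
  rw [EuclideanSpace.norm_eq]
  refine Real.sqrt_le_iff.2 ⟨by positivity, ?_⟩
  rw [Fin.sum_univ_three]
  have h : ∀ i, ‖p i‖ ^ 2 ≤ Real.pi ^ 2 := fun i => by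
    rw [Real.norm_eq_abs, sq_abs]
    exact sq_le_sq' (hp i).1 (hp i).2
  nlinarith [h 0, h 1, h 2, Real.pi_pos]

lemma integral_dualCell_cexp (v : Z3) :
    ∫ p in dualCell, Complex.exp ((inner ℝ p (pt v) : ℝ) * Complex.I) =
      if v = 0 then (((2 * Real.pi) ^ 3 : ℝ) : ℂ) else 0 := by
  have h1 : ∀ p : R3, Complex.exp ((inner ℝ p (pt v) : ℝ) * Complex.I) =
      (fun w : Fin 3 → ℝ => ∏ i, Complex.exp ((w i * v i : ℝ) * Complex.I)) (WithLp.ofLp p) :=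
    fun p => by
    simp only []
    rw [← Complex.exp_sum, ← Finset.sum_mul, ← Complex.ofReal_sum]
    congr 3
    simp [pt, PiLp.inner_apply, mul_comm]
  rw [dualCell_eq_preimage, setIntegral_congr_fun ((MeasurableSet.univ_pi fun _ =>
      measurableSet_Icc).preimage (by fun_prop)) (fun p _ => h1 p)]
  refine ((PiLp.volume_preserving_ofLp (Fin 3)).setIntegral_preimage_emb
      (MeasurableEquiv.toLp 2 (Fin 3 → ℝ)).symm.measurableEmbedding (fun w : Fin 3 → ℝ => ∏ i, Complex.exp ((w i * v i : ℝ) * Complex.I))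
      (univ.pi fun _ => Icc (-Real.pi) Real.pi)).trans ?_
  rw [volume_pi, Measure.restrict_pi_pi,
    integral_fintype_prod_eq_prod (fun (i : Fin 3) (t : ℝ) =>
      Complex.exp ((t * v i : ℝ) * Complex.I))]
  simp only [integral_cexp_int_mul]
  split_ifs with h
  · subst h
    simp
  · obtain ⟨i, hi⟩ := Function.ne_iff.1 h
    exact Finset.prod_eq_zero (Finset.mem_univ i) (if_neg hi)

/-- The trigonometric polynomial with given coefficients. -/
def trigPoly (s : Finset Z3) (u : Z3 → ℂ) (p : R3) : ℂ :=
  ∑ j ∈ s, u j * Complex.exp (-(inner ℝ p (pt j) : ℝ) * Complex.I)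

lemma pt_sub (i j : Z3) : pt (i - j) = pt i - pt j := by
  ext l; simp [pt]

lemma continuous_trigPoly (s : Finset Z3) (u : Z3 → ℂ) : Continuous (trigPoly s u) := by
  unfold trigPoly; fun_prop

lemma sq_norm_trigPoly (s : Finset Z3) (u : Z3 → ℂ) (p : R3) :
    ((‖trigPoly s u p‖ ^ 2 : ℝ) : ℂ) = ∑ i ∈ s, ∑ j ∈ s, starRingEnd ℂ (u i) * u j *
      Complex.exp ((inner ℝ p (pt i - pt j) : ℝ) * Complex.I) := by
  rw [Complex.ofReal_pow, ← Complex.conj_mul', trigPoly, map_sum, Finset.sum_mul_sum]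
  refine Finset.sum_congr rfl fun i _ => Finset.sum_congr rfl fun j _ => ?_
  rw [map_mul, ← Complex.exp_conj, mul_mul_mul_comm, ← Complex.exp_add]
  congr 2
  simp only [map_mul, map_neg, Complex.conj_ofReal, Complex.conj_I, inner_sub_right]
  push_cast
  ring

lemma integral_dualCell_sq_norm_trigPoly (s : Finset Z3) (u : Z3 → ℂ) :
    ∫ p in dualCell, ‖trigPoly s u p‖ ^ 2 = (2 * Real.pi) ^ 3 * ∑ i ∈ s, ‖u i‖ ^ 2 := by
  have hfin : IsFiniteMeasure ((volume : Measure R3).restrict dualCell) := by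
    refine ⟨?_⟩
    rw [Measure.restrict_apply_univ]
    refine lt_of_le_of_lt (measure_mono fun p hp => ?_)
      (measure_closedBall_lt_top (x := (0 : R3)) (r := 2 * Real.pi))
    simpa using norm_le_of_mem_dualCell hp
  have hint : ∀ x : R3, Integrable (fun p : R3 => Complex.exp ((inner ℝ p x : ℝ) * Complex.I))
      (volume.restrict dualCell) := fun x =>
    Integrable.of_bound (by fun_prop) 1 (.of_forall fun p => by
      rw [Complex.norm_exp_ofReal_mul_I])
  rw [← Complex.ofReal_inj, ← integral_complex_ofReal]
  simp only [sq_norm_trigPoly]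
  rw [integral_finsetSum _ fun i _ => integrable_finsetSum _ fun j _ => (hint _).const_mul _]
  simp_rw [integral_finsetSum s fun j _ => (hint _).const_mul _, integral_const_mul,
    ← pt_sub, integral_dualCell_cexp, sub_eq_zero]
  rw [Complex.ofReal_mul, Complex.ofReal_sum, Finset.mul_sum]
  refine Finset.sum_congr rfl fun i hi => ?_
  rw [Finset.sum_eq_single_of_mem i hi fun j _ hj => by rw [if_neg (Ne.symm hj), mul_zero],
    if_pos rfl, Complex.conj_mul']
  push_cast
  ring

/-- The matrix of the imaginary part of the free Green's function on the lattice is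
bounded below. -/
lemma exists_imKernel_coercive {k κ : ℝ} (hk : 0 < k) (hκ : 0 < κ) :
    ∃ c : ℝ, 0 < c ∧ ∀ (s : Finset Z3) (u : Z3 → ℂ), c * ∑ i ∈ s, ‖u i‖ ^ 2 ≤
      (∑ i ∈ s, ∑ j ∈ s, starRingEnd ℂ (u i) * u j * (imKernel k κ (pt i - pt j) : ℂ)).re := by
  have hpi := Real.pi_pos
  -- This is `2kκ/(2π)³`: the numerator of `Im 1/(|p|² - z)` over the Fourier normalization.
  set a : ℝ := k * κ / (4 * Real.pi ^ 3) with ha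
  have ha0 : 0 < a := by positivity
  -- A lower bound of the weight for `‖p‖ ≤ 2π`, a ball containing the dual cell.
  set M : ℝ := ((κ ^ 2 + (k + 2 * Real.pi) ^ 2) * (κ ^ 2 + (k + 2 * Real.pi) ^ 2))⁻¹ with hM
  have hM0 : 0 < M := by positivity
  have hc := continuous_resolventWeight hκ k
  have hMle : ∀ p ∈ dualCell, M ≤ resolventWeight k κ ‖p‖ := fun p hp => by
    have h1 := norm_le_of_mem_dualCell hp
    have h2 := norm_nonneg p
    rw [hM, resolventWeight]
    refine inv_anti₀ (by positivity) ?_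
    have h3 : (k - ‖p‖) ^ 2 ≤ (k + 2 * Real.pi) ^ 2 :=
      sq_le_sq' (by linarith) (by linarith)
    gcongr
  refine ⟨a * (M * (2 * Real.pi) ^ 3), by positivity, fun s u => ?_⟩
  have hform : ∑ i ∈ s, ∑ j ∈ s, starRingEnd ℂ (u i) * u j * (imKernel k κ (pt i - pt j) : ℂ) =
      ((a * ∫ p : R3, resolventWeight k κ ‖p‖ * ‖trigPoly s u p‖ ^ 2 : ℝ) : ℂ) := by
    rw [Complex.ofReal_mul, ← integral_complex_ofReal]
    have hint : ∀ i j, Integrable fun p : R3 => starRingEnd ℂ (u i) * u j *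
        ((resolventWeight k κ ‖p‖ : ℂ) *
          Complex.exp ((inner ℝ p (pt i - pt j) : ℝ) * Complex.I)) := fun i j =>
      (integrable_resolventWeight_mul_cexp hκ k _).const_mul _
    have hpt : ∀ p : R3, ((resolventWeight k κ ‖p‖ * ‖trigPoly s u p‖ ^ 2 : ℝ) : ℂ) =
        ∑ i ∈ s, ∑ j ∈ s, starRingEnd ℂ (u i) * u j * ((resolventWeight k κ ‖p‖ : ℂ) *
          Complex.exp ((inner ℝ p (pt i - pt j) : ℝ) * Complex.I)) := fun p => by
      rw [Complex.ofReal_mul, sq_norm_trigPoly, Finset.mul_sum]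
      refine Finset.sum_congr rfl fun i _ => ?_
      rw [Finset.mul_sum]
      exact Finset.sum_congr rfl fun j _ => by ring
    simp only [hpt]
    rw [integral_finsetSum _ fun i _ => integrable_finsetSum _ fun j _ => hint i j,
      Finset.mul_sum]
    refine Finset.sum_congr rfl fun i _ => ?_
    rw [integral_finsetSum _ fun j _ => hint i j, Finset.mul_sum]
    refine Finset.sum_congr rfl fun j _ => ?_
    rw [integral_const_mul, ← integral_resolventWeight_mul_cexp hk hκ]
    ring
  rw [hform, Complex.ofReal_re, mul_assoc, mul_assoc, ← integral_dualCell_sq_norm_trigPoly,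
    ← integral_const_mul]
  refine mul_le_mul_of_nonneg_left ?_ ha0.le
  have hint : Integrable fun p : R3 => resolventWeight k κ ‖p‖ * ‖trigPoly s u p‖ ^ 2 := by
    obtain ⟨C, hC⟩ := exists_resolventWeight_le hκ k
    refine (integrable_radial hc hC).mul_bdd (c := (∑ j ∈ s, ‖u j‖) ^ 2)
      ((continuous_trigPoly s u).norm.pow 2).aestronglyMeasurable (.of_forall fun p => ?_)
    rw [norm_pow, norm_norm]
    refine pow_le_pow_left₀ (norm_nonneg _) ?_ 2
    refine (norm_sum_le _ _).trans (Finset.sum_le_sum fun j _ => ?_)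
    rw [norm_mul, ← Complex.ofReal_neg, Complex.norm_exp_ofReal_mul_I, mul_one]
  have hnn : ∀ p : R3, 0 ≤ resolventWeight k κ ‖p‖ * ‖trigPoly s u p‖ ^ 2 := fun p =>
    mul_nonneg (resolventWeight_pos hκ k _).le (by positivity)
  -- The integrand is nonnegative, so momenta outside the dual cell may be dropped.
  refine le_trans ?_ (setIntegral_le_integral (s := dualCell) hint (.of_forall hnn))
  refine integral_mono_of_nonneg (.of_forall fun p => by positivity) hint.restrict ?_
  refine (ae_restrict_iff' measurableSet_dualCell).2 (.of_forall fun p hp => ?_)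
  exact mul_le_mul_of_nonneg_right (hMle p hp) (by positivity)

/-! ### Exponential sums over the lattice. -/

section LatticeSums

lemma summable_exp_neg_mul_abs_int {a : ℝ} (ha : 0 < a) :
    Summable fun n : ℤ => Real.exp (-a * |(n : ℝ)|) := by
  have h : Summable fun n : ℕ => Real.exp (-a * n) := by
    simpa [mul_comm] using Real.summable_exp_nat_mul_iff.2 (neg_lt_zero.2 ha)
  refine Summable.of_nat_of_neg ?_ ?_ <;> simpa using h

lemma summable_prod_int {f : ℤ → ℝ} (hf0 : ∀ n, 0 ≤ f n) (hf : Summable f) (n : ℕ) :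
    Summable fun m : Fin n → ℤ => ∏ i, f (m i) := by
  induction n with
  | zero => exact (hasSum_fintype _).summable
  | succ n ih =>
    rw [← (Fin.consEquiv fun _ : Fin (n + 1) => ℤ).summable_iff]
    refine (hf.mul_of_nonneg ih hf0 fun m => Finset.prod_nonneg fun i _ => hf0 _).congr fun p => ?_
    simp [Fin.prod_univ_succ, Fin.consEquiv]

lemma abs_apply_le_norm (x : R3) (i : Fin 3) : |x i| ≤ ‖x‖ := PiLp.norm_apply_le x i

/-- Each coordinate is at most the norm, so the exponential is dominated by a product of three
one-dimensional ones at rate `a / 3`. -/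
lemma summable_exp_neg_mul_norm_pt {a : ℝ} (ha : 0 < a) :
    Summable fun m : Z3 => Real.exp (-a * ‖pt m‖) := by
  refine Summable.of_nonneg_of_le (fun m => (Real.exp_pos _).le) (fun m => ?_)
    (summable_prod_int (fun n => (Real.exp_pos _).le)
      (summable_exp_neg_mul_abs_int (a := a / 3) (by positivity)) 3)
  rw [← Real.exp_sum, Real.exp_le_exp, ← Finset.mul_sum, Fin.sum_univ_three]
  have h : ∀ i, |(m i : ℝ)| ≤ ‖pt m‖ := fun i => abs_apply_le_norm (pt m) i
  nlinarith [h 0, h 1, h 2]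

lemma exists_norm_sub_pt_le (x : R3) : ∃ m : Z3, ‖x - pt m‖ ≤ 1 := by
  refine ⟨fun i => round (x i), ?_⟩
  rw [EuclideanSpace.norm_eq]
  refine Real.sqrt_le_iff.2 ⟨zero_le_one, ?_⟩
  rw [Fin.sum_univ_three]
  have h : ∀ i, ‖(x - pt fun i => round (x i)) i‖ ^ 2 ≤ (1 / 2) ^ 2 := fun i =>
    pow_le_pow_left₀ (norm_nonneg _) (by simpa [pt] using abs_sub_round (x i)) 2
  nlinarith [h 0, h 1, h 2]

/-- Lattice sums of an exponential are bounded uniformly in the centre. -/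
lemma exists_tsum_exp_neg_le {a : ℝ} (ha : 0 < a) :
    ∃ S : ℝ, 0 < S ∧ ∀ x : R3, (Summable fun m : Z3 => Real.exp (-a * ‖x - pt m‖)) ∧
      ∑' m : Z3, Real.exp (-a * ‖x - pt m‖) ≤ S := by
  have h0 := summable_exp_neg_mul_norm_pt ha
  refine ⟨Real.exp a * ∑' m : Z3, Real.exp (-a * ‖pt m‖),
    mul_pos (Real.exp_pos _) (h0.tsum_pos (fun m => (Real.exp_pos _).le) 0 (Real.exp_pos _)),
    fun x => ?_⟩
  -- Moving the centre to a lattice point within distance one costs the factor `e^a` and reduces to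
  -- the sum centred at the origin.
  obtain ⟨l, hl⟩ := exists_norm_sub_pt_le x
  have hle : ∀ m : Z3, Real.exp (-a * ‖x - pt m‖) ≤
      Real.exp a * Real.exp (-a * ‖pt (m - l)‖) := fun m => by
    rw [← Real.exp_add, Real.exp_le_exp]
    have : ‖pt (m - l)‖ ≤ ‖x - pt m‖ + 1 := by
      rw [pt_sub]
      calc ‖pt m - pt l‖ = ‖(x - pt l) - (x - pt m)‖ := by congr 1; abel
        _ ≤ ‖x - pt l‖ + ‖x - pt m‖ := norm_sub_le _ _
        _ ≤ _ := by linarith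
    nlinarith
  have hs : Summable fun m : Z3 => Real.exp a * Real.exp (-a * ‖pt (m - l)‖) :=
    ((Equiv.subRight l).summable_iff.2 h0).mul_left _
  have hsx := Summable.of_nonneg_of_le (fun m => (Real.exp_pos _).le) hle hs
  refine ⟨hsx, (hsx.tsum_le_tsum hle hs).trans_eq ?_⟩
  rw [tsum_mul_left]
  congr 1
  exact (Equiv.subRight l).tsum_eq fun m => Real.exp (-a * ‖pt m‖)

lemma one_le_norm_pt {v : Z3} (hv : v ≠ 0) : 1 ≤ ‖pt v‖ := by
  obtain ⟨i, hi⟩ := Function.ne_iff.1 hv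
  refine le_trans ?_ (abs_apply_le_norm (pt v) i)
  have : (1 : ℤ) ≤ |v i| := Int.one_le_abs hi
  change (1 : ℝ) ≤ |((v i : ℤ) : ℝ)|
  exact_mod_cast this

end LatticeSums

/-! ### Bounded operators on square-summable sequences and their matrices. -/

section Operators

lemma matrixElement_eq (A : L2Z3 →L[ℂ] L2Z3) (i j : Z3) :
    matrixElement A i j = (A (basisVec j) : Z3 → ℂ) i := by
  simp [matrixElement, basisVec, lp.inner_single_left]

lemma norm_basisVec (i : Z3) : ‖basisVec i‖ = 1 := by
  simp [basisVec, lp.norm_single]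

lemma matrixElement_ext {A B : L2Z3 →L[ℂ] L2Z3}
    (h : ∀ i j, matrixElement A i j = matrixElement B i j) : A = B := by
  refine lp.ext_continuousLinearMap (by simp) fun j => ?_
  ext i
  simpa [matrixElement_eq, basisVec] using h i j

/-- Permuting the coordinates of a square-summable sequence and multiplying them by bounded
weights. -/
lemma exists_weightedPermutation (σ : Z3 ≃ Z3) {a : Z3 → ℂ} {C : ℝ} (ha : ∀ i, ‖a i‖ ≤ C) :
    ∃ W : L2Z3 →L[ℂ] L2Z3, (∀ u i, (W u : Z3 → ℂ) i = a i * u (σ i)) ∧ ‖W‖ ≤ C := by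
  have hC : 0 ≤ C := (norm_nonneg _).trans (ha 0)
  have h2 : 0 < (2 : ENNReal).toReal := by simp
  have hle : ∀ (u : L2Z3) i, ‖a i * u (σ i)‖ ^ (2 : ENNReal).toReal ≤
      C ^ (2 : ENNReal).toReal * ‖u (σ i)‖ ^ (2 : ENNReal).toReal := fun u i => by
    rw [norm_mul, ← Real.mul_rpow hC (norm_nonneg _)]
    gcongr
    exact ha i
  have hsum : ∀ u : L2Z3, Summable fun i =>
      C ^ (2 : ENNReal).toReal * ‖u (σ i)‖ ^ (2 : ENNReal).toReal := fun u =>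
    (σ.summable_iff.2 ((lp.memℓp u).summable h2)).mul_left _
  have hmem : ∀ u : L2Z3, Memℓp (fun i => a i * u (σ i)) 2 := fun u =>
    memℓp_gen ((hsum u).of_nonneg_of_le (fun i => by positivity) (hle u))
  let T : L2Z3 →ₗ[ℂ] L2Z3 :=
    { toFun := fun u => ⟨fun i => a i * u (σ i), hmem u⟩
      map_add' := fun u v => by ext i; exact mul_add _ _ _
      map_smul' := fun c u => by ext i; exact mul_left_comm _ _ _ }
  have hT : ∀ u, ‖T u‖ ≤ C * ‖u‖ := fun u => by
    refine lp.norm_le_of_tsum_le h2 (by positivity) ?_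
    rw [Real.mul_rpow hC (norm_nonneg _), lp.norm_rpow_eq_tsum h2 u, ← tsum_mul_left,
      ← σ.tsum_eq fun i => C ^ (2 : ENNReal).toReal * ‖u i‖ ^ (2 : ENNReal).toReal]
    exact ((hsum u).of_nonneg_of_le (fun i => by positivity) (hle u)).tsum_le_tsum (hle u) (hsum u)
  exact ⟨T.mkContinuous C hT, fun u i => rfl, T.mkContinuous_norm_le hC hT⟩

/-- A matrix dominated by a summable convolution kernel defines a bounded operator. -/
lemma exists_operator_of_matrix {K : Z3 → Z3 → ℂ} {k : Z3 → ℝ} (hk : Summable k)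
    (hK : ∀ i j, ‖K i j‖ ≤ k (i - j)) :
    ∃ A : L2Z3 →L[ℂ] L2Z3, (∀ i j, matrixElement A i j = K i j) ∧ ‖A‖ ≤ ∑' v, k v := by
  -- `W v` is the `v`-th diagonal of the matrix, a weighted shift of norm at most `k v`; the
  -- operator is the norm-convergent sum of its diagonals.
  have hW : ∀ v : Z3, ∃ W : L2Z3 →L[ℂ] L2Z3,
      (∀ u i, (W u : Z3 → ℂ) i = K i (i - v) * u (i - v)) ∧ ‖W‖ ≤ k v := fun v =>
    exists_weightedPermutation (Equiv.subRight v) (a := fun i => K i (i - v)) fun i => by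
      simpa using hK i (i - v)
  choose W hW hWn using hW
  have hs : Summable fun v => ‖W v‖ := hk.of_nonneg_of_le (fun _ => norm_nonneg _) hWn
  have hsW : Summable W := hs.of_norm
  refine ⟨∑' v, W v, fun i j => ?_, (norm_tsum_le_tsum_norm hs).trans (hs.tsum_le_tsum hWn hk)⟩
  have h1 : HasSum (fun v => matrixElement (W v) i j) (matrixElement (∑' v, W v) i j) := by
    have := (hsW.hasSum.mapL ((ContinuousLinearMap.apply ℂ L2Z3 (basisVec j)))).mapL
      (innerSL ℂ (basisVec i))
    exact this
  refine h1.unique ?_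
  have h2 := hasSum_ite_eq (i - j) (K i j)
  refine h2.congr_fun fun v => ?_
  rw [matrixElement_eq, hW, basisVec, lp.single_apply]
  by_cases hv : v = i - j
  · subst hv; simp
  · have : i - v ≠ j := fun h => hv (by rw [← h]; abel)
    simp [hv, this]

/-- A bounded operator on a Hilbert space whose form is bounded below is invertible. -/
lemma exists_continuousLinearEquiv_of_le_norm_inner {H : Type*} [NormedAddCommGroup H]
    [InnerProductSpace ℂ H] [CompleteSpace H] (A : H →L[ℂ] H) {c : ℝ} (hc : 0 < c)
    (hA : ∀ u, c * ‖u‖ ^ 2 ≤ ‖inner ℂ u (A u)‖) : ∃ e : H ≃L[ℂ] H, (e : H →L[ℂ] H) = A := by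
  have hbound : ∀ u, c * ‖u‖ ≤ ‖A u‖ := fun u => by
    rcases (norm_nonneg u).eq_or_lt with h | h
    · rw [← h, mul_zero]; exact norm_nonneg _
    · have := (hA u).trans (norm_inner_le_norm u (A u))
      nlinarith
  have hanti : AntilipschitzWith (Real.toNNReal c⁻¹) A :=
    A.antilipschitz_of_bound fun u => by
      rw [Real.coe_toNNReal _ (by positivity), inv_mul_eq_div, le_div_iff₀ hc, mul_comm]
      exact hbound u
  have hker : LinearMap.ker A.toLinearMap = ⊥ := LinearMap.ker_eq_bot.2 hanti.injective
  have hclosed : IsClosed (LinearMap.range A.toLinearMap : Set H) := by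
    rw [LinearMap.coe_range]
    exact hanti.isClosed_range A.uniformContinuous
  have hrange : LinearMap.range A.toLinearMap = ⊤ := by
    have : CompleteSpace (LinearMap.range A.toLinearMap) := hclosed.completeSpace_coe
    -- A vector orthogonal to the closed range is orthogonal to its own image, so coercivity kills
    -- it.
    rw [← Submodule.orthogonal_eq_bot_iff, Submodule.eq_bot_iff]
    intro v hv
    have h0 : inner ℂ v (A v) = 0 :=
      (Submodule.mem_orthogonal' _ _).1 hv _ (LinearMap.mem_range_self A.toLinearMap v)
    have h1 := hA v
    rw [h0, norm_zero] at h1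
    have h2 : ‖v‖ ^ 2 ≤ 0 := by
      by_contra h
      nlinarith [mul_pos hc (not_le.1 h)]
    exact norm_eq_zero.1 (pow_eq_zero_iff two_ne_zero |>.1 (le_antisymm h2 (by positivity)))
  exact ⟨ContinuousLinearEquiv.ofBijective A hker hrange, by ext; simp⟩

end Operators

/-! ### The operator `Γ(z, ω)` and its uniform coercivity. -/

variable {z : ℂ}

/-- The argument of `z` lies strictly between `0` and `π`, and halving it lands in the open first
quadrant. -/
lemma sqrtC_re_pos_and_im_pos (hz : 0 < z.im) :
    0 < (sqrtC z).re ∧ 0 < (sqrtC z).im := by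
  have hz0 : z ≠ 0 := fun h => by simp [h] at hz
  have h1 : Complex.log z * (1 / 2) =
      ((Real.log ‖z‖ / 2 : ℝ) : ℂ) + ((z.arg / 2 : ℝ) : ℂ) * Complex.I := by
    rw [Complex.log]; push_cast; ring
  have harg : 0 < z.arg ∧ z.arg < Real.pi := by
    refine ⟨lt_of_le_of_ne (Complex.arg_nonneg_iff.2 hz.le) fun h => ?_,
      lt_of_le_of_ne (Complex.arg_le_pi z) fun h => ?_⟩
    · exact hz.ne' (Complex.arg_eq_zero_iff.1 h.symm).2
    · exact hz.ne' (Complex.arg_eq_pi_iff.1 h).2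
  rw [sqrtC, Complex.cpow_def_of_ne_zero hz0, h1, Complex.exp_re, Complex.exp_im]
  simp only [Complex.add_im, Complex.ofReal_im, Complex.mul_im, Complex.ofReal_re, Complex.I_im,
    Complex.I_re, mul_one, mul_zero, add_zero, zero_add]
  exact ⟨mul_pos (Real.exp_pos _) (Real.cos_pos_of_mem_Ioo ⟨by linarith, by linarith⟩),
    mul_pos (Real.exp_pos _) (Real.sin_pos_of_pos_of_lt_pi (by linarith) (by linarith))⟩

lemma norm_G0 (z : ℂ) (x y : R3) :
    ‖G0 z x y‖ = Real.exp (-(sqrtC z).im * ‖x - y‖) / (4 * Real.pi * ‖x - y‖) := by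
  rw [G0, norm_mul, norm_div, norm_div, Complex.norm_exp, norm_mul]
  simp [abs_of_pos Real.pi_pos]
  ring

lemma G0_im {x y : R3} (h : x ≠ y) :
    (G0 z x y).im = imKernel (sqrtC z).re (sqrtC z).im (x - y) := by
  have h1 : Complex.I * sqrtC z * (‖x - y‖ : ℂ) = ((-(sqrtC z).im * ‖x - y‖ : ℝ) : ℂ) +
      (((sqrtC z).re * ‖x - y‖ : ℝ) : ℂ) * Complex.I := by
    conv_lhs => rw [← Complex.re_add_im (sqrtC z)]
    push_cast
    linear_combination ((sqrtC z).im * ‖x - y‖ : ℂ) * Complex.I_sq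
  have h2 : G0 z x y = ((1 / (4 * Real.pi * ‖x - y‖) : ℝ) : ℂ) *
      Complex.exp (Complex.I * sqrtC z * (‖x - y‖ : ℂ)) := by
    rw [G0]; push_cast; ring
  rw [h2, Complex.im_ofReal_mul, h1, Complex.exp_im, imKernel, if_neg (sub_ne_zero.2 h)]
  simp only [Complex.add_im, Complex.ofReal_im, Complex.mul_im, Complex.ofReal_re, Complex.I_im,
    Complex.I_re, mul_one, mul_zero, add_zero, zero_add, Complex.add_re, Complex.mul_re, sub_zero]
  ring

lemma pt_injective : Function.Injective pt := fun i j h => by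
  by_contra hij
  have := one_le_norm_pt (sub_ne_zero.2 hij)
  rw [pt_sub, h, sub_self, norm_zero] at this
  linarith

/-- The right side is free of `ω`, which is the source of all uniformity. On the diagonal, `Re √z /
4π` is the value given to `imKernel` at the origin. -/
lemma gammaEntry_im (z : ℂ) (ω : Z3 → ℝ) (i j : Z3) :
    (gammaEntry z ω i j).im = -imKernel (sqrtC z).re (sqrtC z).im (pt i - pt j) := by
  rw [gammaEntry]
  split_ifs with h
  · subst h
    have h1 : (1 / (ω i : ℂ) - Complex.I * e z) = ((1 / ω i : ℝ) : ℂ) -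
        ((1 / (4 * Real.pi) : ℝ) : ℂ) * (Complex.I * sqrtC z) := by
      rw [e]; push_cast; ring
    rw [h1, imKernel, sub_self, if_pos rfl, Complex.sub_im, Complex.im_ofReal_mul,
      Complex.ofReal_im, Complex.I_mul_im]
    ring
  · rw [Complex.neg_im, G0_im (pt_injective.ne h)]

lemma gammaEntry_comm (z : ℂ) (ω : Z3 → ℝ) (i j : Z3) :
    gammaEntry z ω i j = gammaEntry z ω j i := by
  rw [gammaEntry, gammaEntry]
  by_cases h : i = j
  · subst h; rfl
  · rw [if_neg h, if_neg (Ne.symm h), G0, G0, norm_sub_rev]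

lemma norm_gammaEntry_le_of_ne (z : ℂ) (ω : Z3 → ℝ) {i j : Z3} (h : i ≠ j) :
    ‖gammaEntry z ω i j‖ ≤ Real.exp (-(sqrtC z).im * ‖pt (i - j)‖) := by
  have h1 : 1 ≤ ‖pt (i - j)‖ := one_le_norm_pt (sub_ne_zero.2 h)
  rw [gammaEntry, if_neg h, norm_neg, norm_G0, ← pt_sub]
  refine div_le_self (Real.exp_pos _).le ?_
  nlinarith [Real.pi_gt_three]

/-- The matrix `Γ(z, ω)` defines a bounded operator. -/
lemma exists_gammaOperator (hz : 0 < z.im) {ω : Z3 → ℝ} {a : ℝ} (ha : 0 < a)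
    (hω : ∀ j, a ≤ |ω j|) :
    ∃ A : L2Z3 →L[ℂ] L2Z3, ∀ i j, matrixElement A i j = gammaEntry z ω i j := by
  obtain ⟨A, hA, -⟩ := exists_operator_of_matrix (K := gammaEntry z ω)
    (k := fun v => (1 / a + ‖e z‖ + 1) * Real.exp (-(sqrtC z).im * ‖pt v‖))
    ((summable_exp_neg_mul_norm_pt (sqrtC_re_pos_and_im_pos hz).2).mul_left _) fun i j => by
      by_cases h : i = j
      · subst h
        have hpt : ‖pt (i - i)‖ = 0 := by rw [pt_sub, sub_self, norm_zero]
        simp only [hpt, mul_zero, Real.exp_zero, mul_one]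
        rw [gammaEntry, if_pos rfl]
        refine (norm_sub_le _ _).trans ?_
        rw [norm_div, norm_one, norm_mul, Complex.norm_I, one_mul, Complex.norm_real,
          Real.norm_eq_abs]
        have := one_div_le_one_div_of_le ha (hω i)
        linarith
      · refine (norm_gammaEntry_le_of_ne z ω h).trans (le_mul_of_one_le_left
          (Real.exp_pos _).le ?_)
        have : 0 ≤ 1 / a + ‖e z‖ := by positivity
        linarith
  exact ⟨A, hA⟩

lemma hasSum_apply_smul_basisVec (u : L2Z3) : HasSum (fun i => u i • basisVec i) u := by
  refine (lp.hasSum_single (by simp) u).congr_fun fun i => ?_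
  rw [basisVec, ← lp.single_smul, smul_eq_mul, mul_one]

lemma norm_sq_sum_smul_basisVec (s : Finset Z3) (u : Z3 → ℂ) :
    ‖∑ i ∈ s, u i • basisVec i‖ ^ 2 = ∑ i ∈ s, ‖u i‖ ^ 2 := by
  have h := lp.norm_sum_single (E := fun _ : Z3 => ℂ) (p := 2) (by simp) u s
  simp only [ENNReal.toReal_ofNat, Real.rpow_ofNat] at h
  rw [← h]
  congr 2
  refine Finset.sum_congr rfl fun i _ => ?_
  rw [basisVec, ← lp.single_smul, smul_eq_mul, mul_one]

lemma inner_sum_smul_basisVec (A : L2Z3 →L[ℂ] L2Z3) (s : Finset Z3) (u : Z3 → ℂ) :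
    inner ℂ (∑ i ∈ s, u i • basisVec i) (A (∑ i ∈ s, u i • basisVec i)) =
      ∑ i ∈ s, ∑ j ∈ s, starRingEnd ℂ (u i) * u j * matrixElement A i j := by
  rw [map_sum, sum_inner]
  refine Finset.sum_congr rfl fun i _ => ?_
  rw [inner_sum]
  refine Finset.sum_congr rfl fun j _ => ?_
  rw [map_smul, inner_smul_left, inner_smul_right, matrixElement]
  ring

/-- The imaginary part of the form of a complex symmetric matrix. -/
lemma im_sum_conj_mul_mul (s : Finset Z3) (u : Z3 → ℂ) {K : Z3 → Z3 → ℂ}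
    (hK : ∀ i j, K i j = K j i) :
    (∑ i ∈ s, ∑ j ∈ s, starRingEnd ℂ (u i) * u j * K i j).im =
      (∑ i ∈ s, ∑ j ∈ s, starRingEnd ℂ (u i) * u j * ((K i j).im : ℂ)).re := by
  -- A real symmetric matrix is Hermitian, so its form is real.
  have hre : (∑ i ∈ s, ∑ j ∈ s, starRingEnd ℂ (u i) * u j * ((K i j).re : ℂ)).im = 0 := by
    rw [← Complex.conj_eq_iff_im, map_sum]
    simp only [map_sum, map_mul, Complex.conj_conj, Complex.conj_ofReal]
    rw [Finset.sum_comm]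
    refine Finset.sum_congr rfl fun i _ => Finset.sum_congr rfl fun j _ => ?_
    rw [hK j i]; ring
  have h : ∑ i ∈ s, ∑ j ∈ s, starRingEnd ℂ (u i) * u j * K i j =
      ∑ i ∈ s, ∑ j ∈ s, starRingEnd ℂ (u i) * u j * ((K i j).re : ℂ) +
      (∑ i ∈ s, ∑ j ∈ s, starRingEnd ℂ (u i) * u j * ((K i j).im : ℂ)) * Complex.I := by
    simp only [Finset.sum_mul, ← Finset.sum_add_distrib]
    refine Finset.sum_congr rfl fun i _ => Finset.sum_congr rfl fun j _ => ?_
    conv_lhs => rw [← Complex.re_add_im (K i j)]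
    ring
  rw [h, Complex.add_im, hre, zero_add, Complex.mul_I_im]

/-- The imaginary part of `Γ(z, ω)` is bounded below, uniformly in `ω`. -/
lemma exists_gamma_coercive (hz : 0 < z.im) :
    ∃ c : ℝ, 0 < c ∧ ∀ (ω : Z3 → ℝ) (A : L2Z3 →L[ℂ] L2Z3),
      (∀ i j, matrixElement A i j = gammaEntry z ω i j) →
        ∀ u, c * ‖u‖ ^ 2 ≤ ‖inner ℂ u (A u)‖ := by
  obtain ⟨hk, hκ⟩ := sqrtC_re_pos_and_im_pos hz
  obtain ⟨c, hc, hcoer⟩ := exists_imKernel_coercive hk hκ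
  refine ⟨c, hc, fun ω A hA u => ?_⟩
  have hfin : ∀ s : Finset Z3, c * ‖∑ i ∈ s, u i • basisVec i‖ ^ 2 ≤
      ‖inner ℂ (∑ i ∈ s, u i • basisVec i) (A (∑ i ∈ s, u i • basisVec i))‖ := fun s => by
    refine le_trans ?_ (Complex.abs_im_le_norm _)
    refine le_trans ?_ (neg_le_abs _)
    rw [inner_sum_smul_basisVec, norm_sq_sum_smul_basisVec]
    simp only [hA]
    rw [im_sum_conj_mul_mul s u (gammaEntry_comm z ω)]
    refine (hcoer s u).trans_eq ?_
    simp only [gammaEntry_im, Complex.ofReal_neg, mul_neg, Finset.sum_neg_distrib, Complex.neg_re,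
      neg_neg]
  -- Finitely supported vectors are dense and both sides are continuous.
  have hlim := hasSum_apply_smul_basisVec u
  refine le_of_tendsto_of_tendsto ((hlim.norm.pow 2).const_mul c)
    (Filter.Tendsto.norm (hlim.inner ((A.continuous.tendsto u).comp hlim))) (.of_forall hfin)

/-! ### Exponential decay of the inverse. -/

lemma abs_exp_sub_one_le (t : ℝ) : |Real.exp t - 1| ≤ |t| * Real.exp |t| := by
  rcases le_total 0 t with h | h
  · rw [abs_of_nonneg h, abs_of_nonneg (by linarith [Real.add_one_le_exp t])]
    have h1 := Real.add_one_le_exp (-t)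
    have h2 : Real.exp (-t) * Real.exp t = 1 := by rw [← Real.exp_add]; simp
    nlinarith [Real.exp_pos t]
  · rw [abs_of_nonpos h, abs_of_nonpos (by linarith [Real.exp_le_one_iff.2 h])]
    have h1 := Real.add_one_le_exp t
    have h2 := Real.add_one_le_exp (-t)
    nlinarith

/-- **Combes–Thomas estimate**: the inverse of `Γ(z, ω)` decays exponentially off the diagonal,
uniformly in `ω`. -/
lemma exists_inverse_decay (hz : 0 < z.im) :
    ∃ C γ : ℝ, 0 < C ∧ 0 < γ ∧ γ ≤ (sqrtC z).im / 4 ∧ ∀ (ω : Z3 → ℝ) (Γ : L2Z3 ≃L[ℂ] L2Z3),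
      (∀ i j, matrixElement (Γ : L2Z3 →L[ℂ] L2Z3) i j = gammaEntry z ω i j) →
        ∀ m n, ‖matrixElement (Γ.symm : L2Z3 →L[ℂ] L2Z3) m n‖ ≤
          C * Real.exp (-γ * ‖pt m - pt n‖) := by
  obtain ⟨c, hc, hcoer⟩ := exists_gamma_coercive hz
  obtain ⟨-, hκ⟩ := sqrtC_re_pos_and_im_pos hz
  set κ := (sqrtC z).im with hκdef
  have hS := summable_exp_neg_mul_norm_pt (a := κ / 2) (by positivity)
  set S := ∑' v : Z3, Real.exp (-(κ / 2) * ‖pt v‖) with hSdef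
  have hS0 : 0 ≤ S := tsum_nonneg fun v => (Real.exp_pos _).le
  -- The first bound lets the Green's function absorb `r e^{γr}` and keep the rate `κ / 2`; the
  -- second makes the perturbation `D` below have norm at most `c / 2`.
  set γ := min (κ / 4) (c * κ / (8 * (S + 1))) with hγdef
  have hγ : 0 < γ := lt_min (by positivity) (by positivity)
  have hγ1 : γ ≤ κ / 4 := min_le_left _ _
  have hγ2 : γ * (4 / κ) * S ≤ c / 2 := by
    have h1 : γ ≤ c * κ / (8 * (S + 1)) := min_le_right _ _
    calc γ * (4 / κ) * S ≤ c * κ / (8 * (S + 1)) * (4 / κ) * (S + 1) := by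
          gcongr
          linarith
      _ = c / 2 := by field_simp; norm_num
  refine ⟨2 / c, γ, by positivity, hγ, hγ1, fun ω Γ hΓ m n => ?_⟩
  -- Truncating the distance to `n` keeps the weight `e^{γφ}` bounded, while `φ n = 0` and `φ m` is
  -- the full distance. The truncation level does not enter the estimates of `D`, which use only
  -- that `φ` is 1-Lipschitz.
  set φ : Z3 → ℝ := fun i => min ‖pt i - pt n‖ ‖pt m - pt n‖ with hφ
  have hφlip : ∀ i j, |φ i - φ j| ≤ ‖pt (i - j)‖ := fun i j => by
    refine (abs_min_sub_min_le_max _ _ _ _).trans ?_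
    rw [sub_self, abs_zero, max_eq_left (abs_nonneg _), pt_sub]
    refine (abs_norm_sub_norm_le _ _).trans_eq ?_
    congr 1; abel
  obtain ⟨M, hM, -⟩ := exists_weightedPermutation (Equiv.refl Z3)
    (a := fun i => (Real.exp (γ * φ i) : ℂ)) (C := Real.exp (γ * ‖pt m - pt n‖)) fun i => by
      rw [Complex.norm_real, Real.norm_of_nonneg (Real.exp_pos _).le]
      gcongr
      exact min_le_right _ _
  simp only [Equiv.refl_apply] at hM
  -- `D` is `M A M⁻¹ - A`, given by its matrix. The diagonal vanishes, so `ω` drops out.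
  obtain ⟨D, hD, hDn⟩ := exists_operator_of_matrix
    (K := fun i j => ((Real.exp (γ * (φ i - φ j)) - 1 : ℝ) : ℂ) * gammaEntry z ω i j)
    (k := fun v => γ * (4 / κ) * Real.exp (-(κ / 2) * ‖pt v‖)) (hS.mul_left _) fun i j => by
      by_cases h : i = j
      · subst h
        simp only [sub_self, mul_zero, Real.exp_zero, Complex.ofReal_zero, zero_mul, norm_zero]
        positivity
      set r := ‖pt (i - j)‖ with hr
      have hr0 : 0 ≤ r := norm_nonneg _
      rw [norm_mul, Complex.norm_real, Real.norm_eq_abs]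
      have h1 : |γ * (φ i - φ j)| ≤ γ * r := by
        rw [abs_mul, abs_of_pos hγ]; exact mul_le_mul_of_nonneg_left (hφlip i j) hγ.le
      have h2 : r ≤ 4 / κ * Real.exp (κ / 4 * r) := by
        have := Real.add_one_le_exp (κ / 4 * r)
        calc r = 4 / κ * (κ / 4 * r) := by field_simp
          _ ≤ _ := by gcongr; linarith
      calc |Real.exp (γ * (φ i - φ j)) - 1| * ‖gammaEntry z ω i j‖
          ≤ (γ * r * Real.exp (γ * r)) * Real.exp (-κ * r) := by
            refine mul_le_mul ((abs_exp_sub_one_le _).trans ?_)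
              (norm_gammaEntry_le_of_ne z ω h) (norm_nonneg _) (by positivity)
            gcongr
        _ ≤ (γ * (4 / κ * Real.exp (κ / 4 * r)) * Real.exp (κ / 4 * r)) * Real.exp (-κ * r) := by
            gcongr
        _ = γ * (4 / κ) * (Real.exp (κ / 4 * r) * Real.exp (κ / 4 * r) * Real.exp (-κ * r)) := by
            ring
        _ = γ * (4 / κ) * Real.exp (-(κ / 2) * r) := by
            rw [← Real.exp_add, ← Real.exp_add]; congr 2; ring
  rw [tsum_mul_left] at hDn
  have hMb : ∀ j, M (basisVec j) = (Real.exp (γ * φ j) : ℂ) • basisVec j := fun j => by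
    ext i
    rw [hM, lp.coeFn_smul, Pi.smul_apply, smul_eq_mul, basisVec, lp.single_apply]
    by_cases h : i = j
    · subst h; rfl
    · simp [h]
  set A : L2Z3 →L[ℂ] L2Z3 := (Γ : L2Z3 →L[ℂ] L2Z3) with hAdef
  have hconj : (A + D).comp M = M.comp A := by
    refine matrixElement_ext fun i j => ?_
    have h1 : matrixElement (M.comp A) i j = Real.exp (γ * φ i) * matrixElement A i j := by
      rw [matrixElement_eq, matrixElement_eq, ContinuousLinearMap.comp_apply, hM]
    have h2 : matrixElement ((A + D).comp M) i j =
        Real.exp (γ * φ j) * (matrixElement A i j + matrixElement D i j) := by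
      rw [matrixElement_eq, matrixElement_eq, matrixElement_eq, ContinuousLinearMap.comp_apply,
        hMb, map_smul]
      rfl
    have h3 : Real.exp (γ * φ i) = Real.exp (γ * φ j) * Real.exp (γ * (φ i - φ j)) := by
      rw [← Real.exp_add]; congr 1; ring
    rw [h1, h2, hD, hΓ, h3]
    push_cast
    ring
  set w := Γ.symm (basisVec n) with hw
  have hAw : A w = basisVec n := Γ.apply_symm_apply _
  set u := M w with hu
  -- `M` fixes the basis vector at `n`, because `φ n = 0`.
  have hu1 : ‖(A + D) u‖ = 1 := by
    have : (A + D) u = M (A w) := DFunLike.congr_fun hconj w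
    rw [this, hAw, hMb, hφ]
    simp [norm_basisVec]
  have hu2 : c / 2 * ‖u‖ ≤ 1 := by
    rcases (norm_nonneg u).eq_or_lt with h | h
    · rw [← h, mul_zero]; exact zero_le_one
    have h1 : c * ‖u‖ ^ 2 ≤ ‖inner ℂ u (A u)‖ := hcoer ω A hΓ u
    have h2 : inner ℂ u (A u) = inner ℂ u ((A + D) u) - inner ℂ u (D u) := by
      rw [add_apply, inner_add_right, add_sub_cancel_right]
    have h3 : ‖inner ℂ u ((A + D) u)‖ ≤ ‖u‖ := by
      have := norm_inner_le_norm (𝕜 := ℂ) u ((A + D) u)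
      rwa [hu1, mul_one] at this
    have h4 : ‖inner ℂ u (D u)‖ ≤ c / 2 * ‖u‖ ^ 2 := by
      calc ‖inner ℂ u (D u)‖ ≤ ‖u‖ * ‖D u‖ := norm_inner_le_norm _ _
        _ ≤ ‖u‖ * (c / 2 * ‖u‖) := by
            gcongr
            exact (D.le_opNorm u).trans (by gcongr; exact hDn.trans hγ2)
        _ = _ := by ring
    have h5 : c * ‖u‖ ^ 2 ≤ ‖u‖ + c / 2 * ‖u‖ ^ 2 := by
      refine h1.trans ?_
      rw [h2]
      exact (norm_sub_le _ _).trans (add_le_add h3 h4)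
    nlinarith
  have hum : (u : Z3 → ℂ) m = Real.exp (γ * ‖pt m - pt n‖) * w m := by
    rw [hu, hM, hφ]; simp
  have hfinal : Real.exp (γ * ‖pt m - pt n‖) * ‖(w : Z3 → ℂ) m‖ ≤ 2 / c := by
    have h1 := lp.norm_apply_le_norm (by simp) u m
    rw [hum, norm_mul, Complex.norm_real, Real.norm_of_nonneg (Real.exp_pos _).le] at h1
    refine h1.trans ?_
    rw [le_div_iff₀ hc]
    linarith
  rw [matrixElement_eq, neg_mul, Real.exp_neg, ← div_eq_mul_inv, le_div_iff₀ (Real.exp_pos _),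
    mul_comm]
  exact hfinal

/-! ### The pointwise bound on the interaction term. -/

lemma d_le_norm_sub_pt (x : R3) (m : Z3) : d x ≤ ‖x - pt m‖ := by
  rw [← dist_eq_norm]
  exact Metric.infDist_le_dist_of_mem ⟨m, rfl⟩

lemma lattice_nonempty : lattice.Nonempty := range_nonempty pt

lemma isClosed_lattice : IsClosed lattice := by
  refine Metric.isClosed_of_pairwise_le_dist one_pos ?_
  rintro _ ⟨i, rfl⟩ _ ⟨j, rfl⟩ h
  rw [dist_eq_norm, ← pt_sub]
  exact one_le_norm_pt (sub_ne_zero.2 fun hij => h (congrArg pt hij))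

lemma d_pos {x : R3} (hx : x ∉ lattice) : 0 < d x :=
  (isClosed_lattice.notMem_iff_infDist_pos lattice_nonempty).1 hx

lemma norm_G0_le_div_d (z : ℂ) {x : R3} (hx : x ∉ lattice) (m : Z3) :
    ‖G0 z x (pt m)‖ ≤ Real.exp (-(sqrtC z).im * ‖x - pt m‖) / d x := by
  rw [norm_G0]
  have h1 := d_pos hx
  have h2 := d_le_norm_sub_pt x m
  gcongr
  nlinarith [Real.pi_gt_three]

lemma G0_comm (z : ℂ) (x y : R3) : G0 z x y = G0 z y x := by
  rw [G0, G0, norm_sub_rev]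

/-- Half of each Green's function's rate `κ` is kept for summation. The other half, with the decay
of `B`, pays for `e^{-γ‖x-y‖}` by the triangle inequality, since `γ ≤ κ/4 ≤ κ/2`. -/
lemma norm_interactionSummand_le {z : ℂ} {B : L2Z3 →L[ℂ] L2Z3} {C γ : ℝ} (hC : 0 ≤ C)
    (hγ0 : 0 ≤ γ) (hγ : γ ≤ (sqrtC z).im / 4)
    (hB : ∀ m n, ‖matrixElement B m n‖ ≤ C * Real.exp (-γ * ‖pt m - pt n‖)) {x y : R3}
    (hx : x ∉ lattice) (hy : y ∉ lattice) (p : Z3 × Z3) :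
    ‖interactionSummand z B x y p‖ ≤ C / (d x * d y) * Real.exp (-γ * ‖x - y‖) *
      (Real.exp (-((sqrtC z).im / 2) * ‖x - pt p.1‖) *
        Real.exp (-((sqrtC z).im / 2) * ‖y - pt p.2‖)) := by
  set κ := (sqrtC z).im
  have hx0 := d_pos hx
  have hy0 := d_pos hy
  rw [interactionSummand, norm_mul, norm_mul, Complex.norm_conj, G0_comm z (pt p.2)]
  calc ‖G0 z x (pt p.1)‖ * ‖matrixElement B p.1 p.2‖ * ‖G0 z y (pt p.2)‖
      ≤ (Real.exp (-κ * ‖x - pt p.1‖) / d x) * (C * Real.exp (-γ * ‖pt p.1 - pt p.2‖)) *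
        (Real.exp (-κ * ‖y - pt p.2‖) / d y) := by
        gcongr
        · exact norm_G0_le_div_d z hx p.1
        · exact hB p.1 p.2
        · exact norm_G0_le_div_d z hy p.2
    _ = C / (d x * d y) * Real.exp (-κ * ‖x - pt p.1‖ + -γ * ‖pt p.1 - pt p.2‖ +
        -κ * ‖y - pt p.2‖) := by
        rw [Real.exp_add, Real.exp_add]; field_simp
    _ ≤ C / (d x * d y) * Real.exp (-γ * ‖x - y‖ +
        (-(κ / 2) * ‖x - pt p.1‖ + -(κ / 2) * ‖y - pt p.2‖)) := by
        refine mul_le_mul_of_nonneg_left (Real.exp_le_exp.2 ?_) (by positivity)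
        have htri : ‖x - y‖ ≤ ‖x - pt p.1‖ + ‖pt p.1 - pt p.2‖ + ‖y - pt p.2‖ := by
          calc ‖x - y‖ = ‖(x - pt p.1) + (pt p.1 - pt p.2) - (y - pt p.2)‖ := by
                congr 1; abel
            _ ≤ _ := (norm_sub_le _ _).trans (by gcongr; exact norm_add_le _ _)
        have hX := norm_nonneg (x - pt p.1)
        have hY := norm_nonneg (y - pt p.2)
        nlinarith [mul_le_mul_of_nonneg_left htri hγ0, mul_le_mul_of_nonneg_right hγ hX,
          mul_le_mul_of_nonneg_right hγ hY, mul_nonneg hγ0 hX, mul_nonneg hγ0 hY]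
    _ = _ := by rw [Real.exp_add, Real.exp_add]; ring

/-- Absolute convergence and pointwise bound for the interaction term, given off-diagonal decay of
the matrix elements. -/
lemma summable_and_norm_interactionTerm_le {z : ℂ} {B : L2Z3 →L[ℂ] L2Z3} {C γ S : ℝ} (hC : 0 ≤ C)
    (hγ0 : 0 ≤ γ) (hγ : γ ≤ (sqrtC z).im / 4)
    (hB : ∀ m n, ‖matrixElement B m n‖ ≤ C * Real.exp (-γ * ‖pt m - pt n‖))
    (hS : ∀ x : R3, (Summable fun m : Z3 => Real.exp (-((sqrtC z).im / 2) * ‖x - pt m‖)) ∧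
      ∑' m : Z3, Real.exp (-((sqrtC z).im / 2) * ‖x - pt m‖) ≤ S)
    {x y : R3} (hx : x ∉ lattice) (hy : y ∉ lattice) :
    Summable (interactionSummand z B x y) ∧
      ‖interactionTerm z B x y‖ ≤ C * S ^ 2 / (d x * d y) * Real.exp (-γ * ‖x - y‖) := by
  have hx0 := d_pos hx
  have hy0 := d_pos hy
  have hle := norm_interactionSummand_le hC hγ0 hγ hB hx hy
  have hsum := (((hS x).1.hasSum.mul (hS y).1.hasSum ((hS x).1.mul_of_nonneg (hS y).1
    (fun _ => (Real.exp_pos _).le) (fun _ => (Real.exp_pos _).le))).mul_left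
      (C / (d x * d y) * Real.exp (-γ * ‖x - y‖)))
  refine ⟨Summable.of_norm_bounded hsum.summable hle,
    (tsum_of_norm_bounded hsum hle).trans ?_⟩
  have h0 : ∀ x : R3, 0 ≤ ∑' m : Z3, Real.exp (-((sqrtC z).im / 2) * ‖x - pt m‖) := fun x =>
    tsum_nonneg fun _ => (Real.exp_pos _).le
  calc C / (d x * d y) * Real.exp (-γ * ‖x - y‖) * _
      ≤ C / (d x * d y) * Real.exp (-γ * ‖x - y‖) * (S * S) := by
        refine mul_le_mul_of_nonneg_left ?_ (by positivity)
        exact mul_le_mul (hS x).2 (hS y).2 (h0 y) ((h0 x).trans (hS x).2)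
    _ = _ := by ring

/-! ### Averages over translated unit cubes. -/

section UnitCube

lemma norm_le_one_of_mem_unitCube {x : R3} (hx : x ∈ unitCube) : ‖x‖ < 1 := by
  rw [EuclideanSpace.norm_eq, Real.sqrt_lt' one_pos, Fin.sum_univ_three]
  have h : ∀ i, ‖x i‖ ^ 2 ≤ (1 / 2) ^ 2 := fun i => pow_le_pow_left₀ (norm_nonneg _) (hx i) 2
  nlinarith [h 0, h 1, h 2]

lemma measurableSet_unitCube : MeasurableSet unitCube := by
  have : IsClosed unitCube := by
    simp only [unitCube, ofPred_forall]
    exact isClosed_iInter fun i => isClosed_le (by fun_prop) continuous_const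
  exact this.measurableSet

lemma norm_le_norm_sub_pt {x : R3} (hx : x ∈ unitCube) (v : Z3) : ‖x‖ ≤ ‖x - pt v‖ := by
  rw [EuclideanSpace.norm_eq, EuclideanSpace.norm_eq]
  refine Real.sqrt_le_sqrt (Finset.sum_le_sum fun i _ => pow_le_pow_left₀ (norm_nonneg _) ?_ 2)
  change |x i| ≤ |x i - (v i : ℝ)|
  by_cases hv : v i = 0
  · simp [hv]
  · have h1 : (1 : ℝ) ≤ |(v i : ℝ)| := by exact_mod_cast Int.one_le_abs hv
    have h2 := abs_sub_abs_le_abs_sub (v i : ℝ) (x i)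
    rw [abs_sub_comm]
    linarith [hx i]

/-- Within the cube no lattice point is closer than the origin; hence the singularity `1/d` is no
worse than `1/‖x‖`. -/
lemma norm_le_d_add_pt {x : R3} (hx : x ∈ unitCube) (m : Z3) : ‖x‖ ≤ d (x + pt m) := by
  refine (Metric.le_infDist lattice_nonempty).2 ?_
  rintro _ ⟨l, rfl⟩
  rw [dist_eq_norm, show x + pt m - pt l = x - pt (l - m) by rw [pt_sub]; abel]
  exact norm_le_norm_sub_pt hx _

lemma add_pt_notMem_lattice {x : R3} (hx : x ∈ unitCube) (hx0 : x ≠ 0) (m : Z3) :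
    x + pt m ∉ lattice := fun h => by
  have h1 := norm_le_d_add_pt hx m
  rw [d, Metric.infDist_zero_of_mem h] at h1
  exact hx0 (norm_le_zero_iff.1 h1)

/-- The polar Jacobian `r²` turns `1/r` into `r`. -/
lemma integrableOn_inv_norm_unitCube : IntegrableOn (fun x : R3 => ‖x‖⁻¹) unitCube := by
  have h : IntegrableOn (fun x : R3 => ‖x‖⁻¹) (Metric.ball 0 1) := by
    rw [integrableOn_fun_norm_addHaar volume (f := fun r : ℝ => r⁻¹)]
    have h1 : Continuous fun r : ℝ => r := continuous_id
    refine IntegrableOn.congr_fun (f := fun r : ℝ => r) ?_ (fun r hr => ?_) measurableSet_Ioo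
    · exact (h1.integrableOn_Icc (a := 0) (b := 1)).mono_set Ioo_subset_Icc_self
    · have : r ≠ 0 := ne_of_gt hr.1
      simp only [finrank_euclideanSpace, Fintype.card_fin, smul_eq_mul]
      field_simp
  exact h.mono_set fun x hx => by simpa using norm_le_one_of_mem_unitCube hx

lemma measurable_G0_left (z : ℂ) (y : R3) : Measurable fun x => G0 z x y := by
  unfold G0; fun_prop

lemma measurable_interactionSummand_add (z : ℂ) (B : L2Z3 →L[ℂ] L2Z3) (a b : R3) (p : Z3 × Z3) :
    Measurable fun q : R3 × R3 => interactionSummand z B (q.1 + a) (q.2 + b) p := by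
  have h1 := (measurable_G0_left z (pt p.1)).comp
    (show Measurable fun q : R3 × R3 => q.1 + a by fun_prop)
  have h2 := (measurable_G0_left z (pt p.2)).comp
    (show Measurable fun q : R3 × R3 => q.2 + b by fun_prop)
  simp only [interactionSummand, G0_comm z (pt p.2)]
  exact ((Complex.continuous_conj.measurable.comp h1).mul_const _).mul h2

lemma ae_unitCube_prod : ∀ᵐ q : R3 × R3 ∂(volume.restrict unitCube).prod (volume.restrict unitCube),
    (q.1 ∈ unitCube ∧ q.1 ≠ 0) ∧ (q.2 ∈ unitCube ∧ q.2 ≠ 0) := by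
  have h : ∀ᵐ x : R3 ∂volume.restrict unitCube, x ∈ unitCube ∧ x ≠ 0 := by
    filter_upwards [ae_restrict_mem measurableSet_unitCube,
      ae_restrict_of_ae (Measure.ae_ne volume (0 : R3))] with x h1 h2 using ⟨h1, h2⟩
  filter_upwards [Measure.quasiMeasurePreserving_fst.ae h,
    Measure.quasiMeasurePreserving_snd.ae h] with q h1 h2 using ⟨h1, h2⟩

/-- A pointwise bound on the interaction term yields a bound averaged over lattice cells. -/
lemma integrableOn_and_integral_interactionTerm_le {z : ℂ} {B : L2Z3 →L[ℂ] L2Z3} {C γ : ℝ}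
    (hC : 0 ≤ C) (hγ : 0 ≤ γ)
    (hB : ∀ x y : R3, x ∉ lattice → y ∉ lattice → Summable (interactionSummand z B x y) ∧
      ‖interactionTerm z B x y‖ ≤ C / (d x * d y) * Real.exp (-γ * ‖x - y‖)) (m n : Z3) :
    IntegrableOn (fun q : R3 × R3 => interactionTerm z B (q.1 + pt m) (q.2 + pt n))
        (unitCube ×ˢ unitCube) (volume.prod volume) ∧
      ∫ x in unitCube, ∫ y in unitCube, ‖interactionTerm z B (x + pt m) (y + pt n)‖ ≤
        C * Real.exp (2 * γ) * (∫ x in unitCube, ‖x‖⁻¹) ^ 2 *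
          Real.exp (-γ * ‖pt n - pt m‖) := by
  set a := C * Real.exp (2 * γ) * Real.exp (-γ * ‖pt n - pt m‖) with ha
  have hg : Integrable (fun q : R3 × R3 => a * (‖q.1‖⁻¹ * ‖q.2‖⁻¹))
      ((volume.restrict unitCube).prod (volume.restrict unitCube)) :=
    (integrableOn_inv_norm_unitCube.mul_prod integrableOn_inv_norm_unitCube).const_mul a
  have hle : ∀ᵐ q : R3 × R3 ∂(volume.restrict unitCube).prod (volume.restrict unitCube),
      ‖interactionTerm z B (q.1 + pt m) (q.2 + pt n)‖ ≤ a * (‖q.1‖⁻¹ * ‖q.2‖⁻¹) := by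
    filter_upwards [ae_unitCube_prod] with q ⟨⟨h1, h10⟩, h2, h20⟩
    refine (hB _ _ (add_pt_notMem_lattice h1 h10 m) (add_pt_notMem_lattice h2 h20 n)).2.trans ?_
    have hn1 : 0 < ‖q.1‖ := norm_pos_iff.2 h10
    have hn2 : 0 < ‖q.2‖ := norm_pos_iff.2 h20
    have hd1 := norm_le_d_add_pt h1 m
    have hd2 := norm_le_d_add_pt h2 n
    -- Both points of the cube have norm below one, so replacing them by the origin costs at most
    -- `2`, whence the factor `e^{2γ}`.
    have hnorm : ‖pt n - pt m‖ - 2 ≤ ‖q.1 + pt m - (q.2 + pt n)‖ := by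
      have : ‖pt n - pt m‖ ≤ ‖q.1 + pt m - (q.2 + pt n)‖ + (‖q.1‖ + ‖q.2‖) := by
        calc ‖pt n - pt m‖ = ‖(q.1 - q.2) - (q.1 + pt m - (q.2 + pt n))‖ := by congr 1; abel
          _ ≤ ‖q.1 - q.2‖ + ‖q.1 + pt m - (q.2 + pt n)‖ := norm_sub_le _ _
          _ ≤ _ := by linarith [norm_sub_le q.1 q.2]
      linarith [norm_le_one_of_mem_unitCube h1, norm_le_one_of_mem_unitCube h2]
    calc C / (d (q.1 + pt m) * d (q.2 + pt n)) * Real.exp (-γ * ‖q.1 + pt m - (q.2 + pt n)‖)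
        ≤ C / (‖q.1‖ * ‖q.2‖) * Real.exp (2 * γ + -γ * ‖pt n - pt m‖) := by
          have hdd : ‖q.1‖ * ‖q.2‖ ≤ d (q.1 + pt m) * d (q.2 + pt n) :=
            mul_le_mul hd1 hd2 hn2.le (hn1.le.trans hd1)
          refine mul_le_mul (div_le_div_of_nonneg_left hC (by positivity) hdd)
            (Real.exp_le_exp.2 ?_) (Real.exp_pos _).le (by positivity)
          nlinarith [mul_le_mul_of_nonneg_left hnorm hγ]
      _ = a * (‖q.1‖⁻¹ * ‖q.2‖⁻¹) := by rw [Real.exp_add, ha]; field_simp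
  -- The double series is an almost everywhere limit of measurable finite sums.
  have hmeas : AEStronglyMeasurable
      (fun q : R3 × R3 => interactionTerm z B (q.1 + pt m) (q.2 + pt n))
      ((volume.restrict unitCube).prod (volume.restrict unitCube)) := by
    have hpart : ∀ s : Finset (Z3 × Z3), Measurable fun q : R3 × R3 =>
        ∑ p ∈ s, interactionSummand z B (q.1 + pt m) (q.2 + pt n) p := fun s =>
      Finset.measurable_fun_sum s fun p _ => measurable_interactionSummand_add z B _ _ p
    refine aestronglyMeasurable_of_tendsto_ae Filter.atTop
      (fun s => (hpart s).aestronglyMeasurable) ?_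
    filter_upwards [ae_unitCube_prod] with q ⟨⟨h1, h10⟩, h2, h20⟩
    exact (hB _ _ (add_pt_notMem_lattice h1 h10 m) (add_pt_notMem_lattice h2 h20 n)).1.hasSum
  have hint := hg.mono' hmeas hle
  refine ⟨by rwa [IntegrableOn, ← Measure.prod_restrict], ?_⟩
  rw [← integral_prod (fun q : R3 × R3 => ‖interactionTerm z B (q.1 + pt m) (q.2 + pt n)‖)
    hint.norm]
  refine (integral_mono_ae hint.norm hg hle).trans_eq ?_
  rw [integral_const_mul, integral_prod_mul (fun x : R3 => ‖x‖⁻¹) fun x : R3 => ‖x‖⁻¹, ha]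
  ring

end UnitCube

end DeltaInteraction

end

theorem theorem2p3 (z : ℂ) (hz : 0 < z.im) :
    ∃ C γ : ℝ, 0 < C ∧ 0 < γ ∧
      ∀ ω : DeltaInteraction.Z3 → ℝ, (∃ a : ℝ, 0 < a ∧ ∀ j, a ≤ |ω j|) →
        -- the matrix `Γ(z, ω)` is that of a bounded, boundedly invertible operator `Γ`
        ∃ Γ : DeltaInteraction.L2Z3 ≃L[ℂ] DeltaInteraction.L2Z3,
          (∀ i j : DeltaInteraction.Z3,
            DeltaInteraction.matrixElement (Γ : DeltaInteraction.L2Z3 →L[ℂ] DeltaInteraction.L2Z3)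
              i j = DeltaInteraction.gammaEntry z ω i j) ∧
          -- the pointwise bound on the (absolutely convergent) interaction term
          (∀ x y : DeltaInteraction.R3,
            x ∉ DeltaInteraction.lattice → y ∉ DeltaInteraction.lattice →
              Summable (DeltaInteraction.interactionSummand z
                (Γ.symm : DeltaInteraction.L2Z3 →L[ℂ] DeltaInteraction.L2Z3) x y) ∧
              ‖DeltaInteraction.interactionTerm z
                (Γ.symm : DeltaInteraction.L2Z3 →L[ℂ] DeltaInteraction.L2Z3) x y‖ ≤
                C / (DeltaInteraction.d x * DeltaInteraction.d y) * Real.exp (-γ * ‖x - y‖)) ∧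
          -- the bound averaged over translated unit cubes
          (∀ m n : DeltaInteraction.Z3,
            MeasureTheory.IntegrableOn
              (fun q : DeltaInteraction.R3 × DeltaInteraction.R3 =>
                DeltaInteraction.interactionTerm z
                  (Γ.symm : DeltaInteraction.L2Z3 →L[ℂ] DeltaInteraction.L2Z3)
                  (q.1 + DeltaInteraction.pt m) (q.2 + DeltaInteraction.pt n))
              (DeltaInteraction.unitCube ×ˢ DeltaInteraction.unitCube)
              (MeasureTheory.volume.prod MeasureTheory.volume) ∧
            ∫ x in DeltaInteraction.unitCube, ∫ y in DeltaInteraction.unitCube,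
                ‖DeltaInteraction.interactionTerm z
                  (Γ.symm : DeltaInteraction.L2Z3 →L[ℂ] DeltaInteraction.L2Z3)
                  (x + DeltaInteraction.pt m) (y + DeltaInteraction.pt n)‖ ≤
              C * Real.exp (-γ * ‖DeltaInteraction.pt n - DeltaInteraction.pt m‖)) := by
  open DeltaInteraction MeasureTheory in
  obtain ⟨c, hc, hcoer⟩ := exists_gamma_coercive hz
  obtain ⟨C, γ, hC, hγ0, hγ, hdecay⟩ := exists_inverse_decay hz
  obtain ⟨S, hS0, hS⟩ := exists_tsum_exp_neg_le (half_pos (sqrtC_re_pos_and_im_pos hz).2)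
  set I := ∫ x in unitCube, ‖x‖⁻¹
  -- The constant is the sum of those of the two bounds, `C S²` pointwise and `C S² e^{2γ} I²`
  -- averaged, so it dominates both.
  refine ⟨C * S ^ 2 * (1 + Real.exp (2 * γ) * I ^ 2), γ, by positivity, hγ0, fun ω hω => ?_⟩
  obtain ⟨a, ha, hω⟩ := hω
  obtain ⟨A, hA⟩ := exists_gammaOperator hz ha hω
  obtain ⟨Γ, hΓ⟩ := exists_continuousLinearEquiv_of_le_norm_inner A hc (hcoer ω A hA)
  have hentry : ∀ i j, matrixElement (Γ : L2Z3 →L[ℂ] L2Z3) i j = gammaEntry z ω i j := by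
    rwa [hΓ]
  have hpoint : ∀ x y : R3, x ∉ lattice → y ∉ lattice → _ := fun x y hx hy =>
    summable_and_norm_interactionTerm_le hC.le hγ0.le hγ (hdecay ω Γ hentry) hS hx hy
  refine ⟨Γ, hentry, fun x y hx hy => ⟨(hpoint x y hx hy).1, (hpoint x y hx hy).2.trans ?_⟩,
    fun m n => ?_⟩
  · have hx0 := d_pos hx
    have hy0 := d_pos hy
    have hI : 0 ≤ Real.exp (2 * γ) * I ^ 2 := by positivity
    have hle : C * S ^ 2 ≤ C * S ^ 2 * (1 + Real.exp (2 * γ) * I ^ 2) :=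
      le_mul_of_one_le_right (by positivity) (by linarith)
    exact mul_le_mul_of_nonneg_right (div_le_div_of_nonneg_right hle (by positivity))
      (Real.exp_pos _).le
  · obtain ⟨h1, h2⟩ := integrableOn_and_integral_interactionTerm_le
      (C := C * S ^ 2) (by positivity) hγ0.le hpoint m n
    refine ⟨h1, h2.trans ?_⟩
    refine mul_le_mul_of_nonneg_right ?_ (Real.exp_pos _).le
    rw [mul_assoc]
    exact mul_le_mul_of_nonneg_left (by linarith) (by positivity)
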